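/- Let $K\subseteq\mathbb{R}^{n+m}$ be closed and convex, and let $\varphi$ be a real-valued function of $\mathbf z=(x,y)\in\mathbb{R}^{n}\times\mathbb{R}^m$ that is $C^2$ on an open neighbourhood of $K$ and concave in $x$, convex in $y$ on $K_x\times K_y$, where $K_x,K_y$ are the coordinate projections of $K$ (if $K=X\times Y$ this is concave-convexity on $K$). Put $\mathbf f=(\varphi_x,-\varphi_y)$ and let $N_K(\mathbf z)=\{\mathbf v:\mathbf v^T(\mathbf w-\mathbf z)\le 0\ \forall \mathbf w\in K\}$ be the normal cone. The subgradient method on $K$ is $$\dot{\mathbf z}=\mathbf f(\mathbf z)-\mathbf P_{N_K(\mathbf z)}(\mathbf f(\mathbf z)),$$ where $\mathbf P_C$ is the Euclidean projection onto $C$; its trajectories are the Carathéodory solutions with values in $K$ (locally absolutely continuous, the equation holding for almost every $t$). Its $\omega$-limit set is $\Omega=\bigcup_{\mathbf w}\bigcap_{t\ge 0}\overline{\mathbf w([t,\infty))}$, the union being over all trajectories $\mathbf w$ on $[0,\infty)$. A point $\bar{\mathbf z}\in K$ is a $K$-restricted saddle point if $\mathbf f(\bar{\mathbf z})\in N_K(\bar{\mathbf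 z})$; for $K=X\times Y$ this says exactly that $\varphi(x,\bar y)\le\varphi(\bar x,\bar y)\le\varphi(\bar x,y)$ for all $x\in X$, $y\in Y$. Let $F$ be the minimal face of $K$ containing all $K$-restricted saddle points, $V$ the affine span of $F$, $N_V$ its normal cone, $\mathbf\Pi$ the orthogonal projection onto the orthogonal complement of $N_V$ (the direction space of $V$), and $$\mathbf A(\mathbf z)=\begin{bmatrix}0&\varphi_{xy}(\mathbf z)\\-\varphi_{yx}(\mathbf z)&0\end{bmatrix},\qquad \mathbf B(\mathbf z)=\begin{bmatrix}\varphi_{xx}(\mathbf z)&0\\0&-\varphi_{yy}(\mathbf z)\end{bmatrix}.$$ Suppose $\mathbf 0$ is a $K$-restricted saddle point. Then every trajectory $\mathbf z(t)$, $t\in\mathbb{R}$, of the subgradient method that lies in $\Omega$ satisfies, for all $t\in\mathbb{R}$, the linear ODE $$\dot{\mathbf z}(t)=\mathbf\Pi\mathbf A(\mathbf 0)\mathbf\Pi\,\mathbf z(t)$$ and, for all $t\in\mathbb{R}$ and $r\in[0,1]$, $$\mathbf z(t)\in\ker\big(\mathbf\Pi\mathbf B(r\mathbf z(t))\mathbf\Pi\big)\cap\ker\big(\mathbf\Pi(\mathbf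 A(r\mathbf z(t))-\mathbf A(\mathbf 0))\mathbf\Pi\big).$$ The same holds for all $t\ge 0$ (with the one-sided derivative at $t=0$) for every trajectory on $[0,\infty)$ with $\mathbf z(0)\in\Omega$. -/

import Mathlib

open Set Filter Topology MeasureTheory

noncomputable section

namespace SubgradientMethod

/-- The Euclidean space `ℝⁿ⁺ᵐ`; the coordinates `Sum.inl i` form the `x`-part and the coordinates
`Sum.inr j` form the `y`-part of a point `z = (x, y)`. -/
abbrev Z (n m : ℕ) : Type := EuclideanSpace ℝ (Fin n ⊕ Fin m)

variable {n m : ℕ}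

/-- The point `(x, y)` of `ℝⁿ⁺ᵐ`. -/
def pair (x : Fin n → ℝ) (y : Fin m → ℝ) : Z n m := WithLp.toLp 2 (Sum.elim x y)

/-- The `x`-part of `z = (x, y)`. -/
def xPart (z : Z n m) : Fin n → ℝ := fun i => z (Sum.inl i)

/-- The `y`-part of `z = (x, y)`. -/
def yPart (z : Z n m) : Fin m → ℝ := fun j => z (Sum.inr j)

/-- `φ(x, y)` is concave in `x` and convex in `y`, on the product of the coordinate projections of
`K`. When `K = X × Y` this is concavity of `φ(·, y)` on `X` for `y ∈ Y` and convexity of `φ(x, ·)`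
on `Y` for `x ∈ X`. -/
def IsConcaveConvexOn (K : Set (Z n m)) (φ : Z n m → ℝ) : Prop :=
  (∀ y ∈ yPart '' K, ConcaveOn ℝ (xPart '' K) (fun x => φ (pair x y))) ∧
  (∀ x ∈ xPart '' K, ConvexOn ℝ (yPart '' K) (fun y => φ (pair x y)))

/-- The partial derivative of `φ` at `z` with respect to the coordinate `k`. -/
def partialDeriv (φ : Z n m → ℝ) (k : Fin n ⊕ Fin m) (z : Z n m) : ℝ :=
  fderiv ℝ φ z (EuclideanSpace.single k 1)

/-- The second partial derivative of `φ` at `z` with respect to the coordinates `k` and `l`. -/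
def partialDeriv₂ (φ : Z n m → ℝ) (k l : Fin n ⊕ Fin m) (z : Z n m) : ℝ :=
  partialDeriv (partialDeriv φ k) l z

/-- The vector field `f(z) = (φ_x(z), -φ_y(z))`. -/
def field (φ : Z n m → ℝ) (z : Z n m) : Z n m :=
  pair (fun i => partialDeriv φ (Sum.inl i) z) (fun j => -partialDeriv φ (Sum.inr j) z)

/-- The matrix `A(z) = [[0, φ_xy(z)], [-φ_yx(z), 0]]`, acting on `ℝⁿ⁺ᵐ`. -/
def matA (φ : Z n m → ℝ) (z : Z n m) : Z n m →L[ℝ] Z n m :=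
  Matrix.toEuclideanCLM (𝕜 := ℝ) (Matrix.fromBlocks
    0 (Matrix.of fun i j => partialDeriv₂ φ (Sum.inl i) (Sum.inr j) z)
    (-Matrix.of fun j i => partialDeriv₂ φ (Sum.inr j) (Sum.inl i) z) 0)

/-- The matrix `B(z) = [[φ_xx(z), 0], [0, -φ_yy(z)]]`, acting on `ℝⁿ⁺ᵐ`. -/
def matB (φ : Z n m → ℝ) (z : Z n m) : Z n m →L[ℝ] Z n m :=
  Matrix.toEuclideanCLM (𝕜 := ℝ) (Matrix.fromBlocks
    (Matrix.of fun i i' => partialDeriv₂ φ (Sum.inl i) (Sum.inl i') z) 0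
    0 (-Matrix.of fun j j' => partialDeriv₂ φ (Sum.inr j) (Sum.inr j') z))

/-- The normal cone `N_K(z)`. -/
def normalCone (K : Set (Z n m)) (z : Z n m) : Set (Z n m) :=
  {v | ∀ w ∈ K, inner ℝ v (w - z) ≤ 0}

/-- `p` is the metric projection `P_C(v)` of `v` onto `C`, the point of `C` nearest to `v`
(it exists and is unique when `C` is non-empty, closed and convex). -/
def IsProjection (C : Set (Z n m)) (v p : Z n m) : Prop :=
  p ∈ C ∧ ∀ q ∈ C, dist v p ≤ dist v q

/-- `z` is a `K`-restricted saddle point of the `C¹` concave-convex function `φ`: `z ∈ K` and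
`(φ_x(z), -φ_y(z)) ∈ N_K(z)`. For `K = X × Y` this is equivalent to the inequalities
`φ(x, ȳ) ≤ φ(x̄, ȳ) ≤ φ(x̄, y)` on `K`, see `isRestrictedSaddle_iff_of_prod`. -/
def IsRestrictedSaddle (K : Set (Z n m)) (φ : Z n m → ℝ) (z : Z n m) : Prop :=
  z ∈ K ∧ field φ z ∈ normalCone K z

/-- `z` is, on the time interval `I`, a Carathéodory solution in `K` of the subgradient method
`ż = f(z) - P_{N_K(z)}(f(z))`. -/
structure IsSubgradientTrajectory (K : Set (Z n m)) (φ : Z n m → ℝ) (I : Set ℝ)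
    (z : ℝ → Z n m) : Prop where
  mem : ∀ t ∈ I, z t ∈ K
  absCont : ∀ a ∈ I, ∀ b ∈ I, AbsolutelyContinuousOnInterval z a b
  ode : ∀ᵐ t ∂(volume.restrict I), ∃ p, IsProjection (normalCone K (z t)) (field φ (z t)) p ∧
    HasDerivAt z (field φ (z t) - p) t

/-- The `ω`-limit set of the subgradient method on `K`: the union over all trajectories `w` of
`⋂_{t ≥ 0} closure (w [t, ∞))`. -/
def omegaLimitSet (K : Set (Z n m)) (φ : Z n m → ℝ) : Set (Z n m) :=
  {p | ∃ w, IsSubgradientTrajectory K φ (Ici 0) w ∧ p ∈ ⋂ t ∈ Ici (0 : ℝ), closure (w '' Ici t)}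

/-- `F` is a face of the convex set `K`. -/
def IsFace (K F : Set (Z n m)) : Prop := Convex ℝ F ∧ IsExtreme ℝ K F

/-- The minimal face of `K` containing `S`. -/
def minimalFace (K S : Set (Z n m)) : Set (Z n m) := ⋂₀ {F | IsFace K F ∧ S ⊆ F}

/-- The affine span `V` of the minimal face of `K` that contains all `K`-restricted saddle
points. -/
def saddleSpan (K : Set (Z n m)) (φ : Z n m → ℝ) : AffineSubspace ℝ (Z n m) :=
  affineSpan ℝ (minimalFace K {z | IsRestrictedSaddle K φ z})

/-- The normal cone `N_V` of the affine subspace `V` is `V.directionᗮ`; `Π` is the orthogonal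
projection onto the orthogonal complement of `N_V`. -/
def projPi (K : Set (Z n m)) (φ : Z n m → ℝ) : Z n m →L[ℝ] Z n m :=
  ((saddleSpan K φ).directionᗮ)ᗮ.starProjection

/-- The linear ODE's right-hand side operator `Π A(0) Π`. -/
def linOp (K : Set (Z n m)) (φ : Z n m → ℝ) : Z n m →L[ℝ] Z n m :=
  projPi K φ ∘L matA φ 0 ∘L projPi K φ

/-- The kernel condition at the point `z`: for all `r ∈ [0, 1]`,
`z ∈ ker(Π B(r z) Π) ∩ ker(Π (A(r z) - A(0)) Π)`. -/
def KernelCondition (K : Set (Z n m)) (φ : Z n m → ℝ) (z : Z n m) : Prop :=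
  ∀ r ∈ Icc (0 : ℝ) 1,
    (projPi K φ ∘L matB φ (r • z) ∘L projPi K φ) z = 0 ∧
    (projPi K φ ∘L (matA φ (r • z) - matA φ 0) ∘L projPi K φ) z = 0

/-! ### The definition of a restricted saddle point on product sets -/

theorem pair_xPart_yPart (z : Z n m) : pair (xPart z) (yPart z) = z := by
  ext k
  cases k <;> rfl

theorem xPart_pair (x : Fin n → ℝ) (y : Fin m → ℝ) : xPart (pair x y) = x := rfl

theorem yPart_pair (x : Fin n → ℝ) (y : Fin m → ℝ) : yPart (pair x y) = y := rfl

theorem inner_field (φ : Z n m → ℝ) (z d : Z n m) :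
    inner ℝ (field φ z) d =
      fderiv ℝ φ z (pair (xPart d) 0) - fderiv ℝ φ z (pair 0 (yPart d)) := by
  have h1 : pair (xPart d) (0 : Fin m → ℝ)
      = ∑ i, d (Sum.inl i) • (EuclideanSpace.single (Sum.inl i) (1 : ℝ) : Z n m) := by
    ext k
    cases k <;> simp [pair, xPart, Pi.single_apply]
  have h2 : pair (0 : Fin n → ℝ) (yPart d)
      = ∑ j, d (Sum.inr j) • (EuclideanSpace.single (Sum.inr j) (1 : ℝ) : Z n m) := by
    ext k
    cases k <;> simp [pair, yPart, Pi.single_apply]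
  rw [h1, h2, map_sum, map_sum]
  simp [field, pair, partialDeriv, PiLp.inner_apply, sub_eq_add_neg]

/-- If `g` is differentiable at `z` and lies above the chord from `z` in the direction `d`, then
the directional derivative bounds the increment. -/
theorem le_fderiv_of_chord {g : Z n m → ℝ} {z d : Z n m} {c : ℝ} (hg : DifferentiableAt ℝ g z)
    (h : ∀ t ∈ Ioo (0 : ℝ) 1, t * c ≤ g (z + t • d) - g z) : c ≤ fderiv ℝ g z d := by
  have hd : HasDerivAt (fun t : ℝ => g (z + t • d)) (fderiv ℝ g z d) 0 := by
    have h0 : HasDerivAt (fun t : ℝ => z + t • d) d 0 := by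
      simpa using ((hasDerivAt_id (0 : ℝ)).smul_const d).const_add z
    have hg' : HasFDerivAt g (fderiv ℝ g z) (z + (0 : ℝ) • d) := by
      simpa using hg.hasFDerivAt
    exact hg'.comp_hasDerivAt (0 : ℝ) h0
  have hs := (hasDerivAt_iff_tendsto_slope.mp hd).mono_left
    (nhdsWithin_mono (0 : ℝ) (fun t (ht : t ∈ Ioi (0 : ℝ)) => ne_of_gt ht))
  refine ge_of_tendsto hs ?_
  filter_upwards [Ioo_mem_nhdsGT (zero_lt_one (α := ℝ))] with t ht
  have := h t ht
  simp only [slope_def_field, zero_smul, add_zero, sub_zero]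
  rw [le_div_iff₀ ht.1]
  linarith

/-- On a product set `K = X × Y`, a point is a `K`-restricted saddle point of the concave-convex
function `φ` if and only if it satisfies the saddle inequalities on `K`. -/
theorem isRestrictedSaddle_iff_of_prod {K : Set (Z n m)} {φ : Z n m → ℝ} {z : Z n m}
    (hprod : ∀ u ∈ K, ∀ v ∈ K, pair (xPart u) (yPart v) ∈ K)
    (hcc : IsConcaveConvexOn K φ) (hd : ∀ u ∈ K, DifferentiableAt ℝ φ u) :
    IsRestrictedSaddle K φ z ↔ z ∈ K ∧
      (∀ x, pair x (yPart z) ∈ K → φ (pair x (yPart z)) ≤ φ z) ∧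
      (∀ y, pair (xPart z) y ∈ K → φ z ≤ φ (pair (xPart z) y)) := by
  refine and_congr_right fun hz => ?_
  have hzx : xPart z ∈ xPart '' K := ⟨z, hz, rfl⟩
  have hzy : yPart z ∈ yPart '' K := ⟨z, hz, rfl⟩
  have ex : ∀ (x : Fin n → ℝ) (t : ℝ), z + t • pair (x - xPart z) 0
      = pair ((1 - t) • xPart z + t • x) (yPart z) := by
    intro x t
    ext k
    cases k
    · simp [pair, xPart]; ring
    · simp [pair, yPart]
  have ey : ∀ (y : Fin m → ℝ) (t : ℝ), z + t • pair 0 (y - yPart z)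
      = pair (xPart z) ((1 - t) • yPart z + t • y) := by
    intro y t
    ext k
    cases k
    · simp [pair, xPart]
    · simp [pair, yPart]; ring
  constructor
  · intro hN
    constructor
    · intro x hx
      have hc := hcc.1 _ hzy
      have hxK : x ∈ xPart '' K := ⟨_, hx, rfl⟩
      have key : φ (pair x (yPart z)) - φ z ≤ fderiv ℝ φ z (pair (x - xPart z) 0) := by
        refine le_fderiv_of_chord (hd z hz) fun t ht => ?_
        have := hc.2 hzx hxK (sub_nonneg.2 ht.2.le) ht.1.le (by ring)
        simp only [pair_xPart_yPart, smul_eq_mul] at this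
        rw [ex]
        linarith
      have h := hN _ hx
      rw [inner_field] at h
      have e1 : xPart (pair x (yPart z) - z) = x - xPart z := by
        ext i; simp [xPart, pair]
      have e2 : pair (0 : Fin n → ℝ) (yPart (pair x (yPart z) - z)) = 0 := by
        ext k; cases k <;> simp [yPart, pair]
      rw [e1, e2, map_zero] at h
      linarith
    · intro y hy
      have hc := hcc.2 _ hzx
      have hyK : y ∈ yPart '' K := ⟨_, hy, rfl⟩
      have key : φ z - φ (pair (xPart z) y) ≤ fderiv ℝ (fun w => -φ w) z (pair 0 (y - yPart z)) := by
        refine le_fderiv_of_chord (hd z hz).neg fun t ht => ?_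
        have := hc.2 hzy hyK (sub_nonneg.2 ht.2.le) ht.1.le (by ring)
        simp only [pair_xPart_yPart, smul_eq_mul] at this
        rw [ey]
        linarith
      have h := hN _ hy
      rw [inner_field] at h
      have e1 : yPart (pair (xPart z) y - z) = y - yPart z := by
        ext i; simp [yPart, pair]
      have e2 : pair (xPart (pair (xPart z) y - z)) (0 : Fin m → ℝ) = 0 := by
        ext k; cases k <;> simp [xPart, pair]
      rw [e1, e2, map_zero] at h
      rw [fderiv_fun_neg] at key
      simp only [neg_apply] at key
      linarith
  · rintro ⟨hx, hy⟩ w hw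
    rw [inner_field]
    have cx : (xPart '' K).Nonempty := ⟨_, hzx⟩
    have hmx : pair (xPart w) (yPart z) ∈ K := hprod w hw z hz
    have hmy : pair (xPart z) (yPart w) ∈ K := hprod z hz w hw
    have k1 : 0 ≤ fderiv ℝ (fun w => -φ w) z (pair (xPart w - xPart z) 0) := by
      refine le_fderiv_of_chord (hd z hz).neg fun t ht => ?_
      rw [ex]
      obtain ⟨u, hu, hu'⟩ := (hcc.1 _ hzy).1 hzx (⟨w, hw, rfl⟩ : xPart w ∈ xPart '' K)
        (sub_nonneg.2 ht.2.le) ht.1.le (by ring)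
      have := hx _ (hu' ▸ hprod u hu z hz)
      linarith
    have k2 : 0 ≤ fderiv ℝ φ z (pair 0 (yPart w - yPart z)) := by
      refine le_fderiv_of_chord (hd z hz) fun t ht => ?_
      rw [ey]
      obtain ⟨u, hu, hu'⟩ := (hcc.2 _ hzx).1 hzy (⟨w, hw, rfl⟩ : yPart w ∈ yPart '' K)
        (sub_nonneg.2 ht.2.le) ht.1.le (by ring)
      have := hy _ (hu' ▸ hprod z hz u hu)
      linarith
    have e1 : xPart (w - z) = xPart w - xPart z := by ext i; simp [xPart]
    have e2 : yPart (w - z) = yPart w - yPart z := by ext i; simp [yPart]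
    rw [fderiv_fun_neg] at k1
    simp only [neg_apply] at k1
    rw [e1, e2]
    linarith

end SubgradientMethod

end

/-! Concave-convexity makes `field φ` monotone in the sense ⟨f(u) - f(w), u - w⟩ ≤ 0
(`field_monotone`), so the flow is nonexpansive. A trajectory z starting in Ω is a limit of time
shifts of one trajectory w. The distance of w to its own shift by h, or to a saddle point p,
decreases to a limit; hence ‖z(t+h) - z(t)‖ and ‖z(t) - p‖ do not depend on t. In particular z is
bounded and almost periodic.

By Minty's lemma the time averages of z accumulate at a saddle point q. A linear functional that is
nonnegative on all z(t) - q is almost periodic with vanishing lower mean, so it is zero. Hence no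
hyperplane through q properly supports the orbit, segments from z(t) to q can be prolonged inside K,
and z(t) lies in F (`mem_minimalFace_of_mem_omegaLimitSet`). Constant distance to the saddle points
also makes the monotonicity and normal cone inequalities equalities: ⟨f(z), z - p⟩ = 0, and the
normal component of the motion is orthogonal to V. So ż = Π f(z).

It remains to see that Π f is linear along the ray from 0 to z. Subtracting from f a skew rank-two
map that agrees with it at z leaves a monotone field with the same value at p and with value 0 at z.
Every point between p and z then solves Minty's inequality for this field, which therefore vanishes
in the two-sided feasible directions (`inner_eq_smul_inner_of_monotone`). Differentiating ⟨f(rz), d⟩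
= r⟨f(z), d⟩ in r gives ⟨(A(rz) + B(rz))z, d⟩ = ⟨f(z), d⟩ for d along V. With d = z the skew A drops
out, so z is isotropic for the semidefinite B(rz). Thus ΠB(rz)z = 0 and ΠA(rz)z = Πf(z) for every r;
r = 0 gives the linear equation. -/

namespace SubgradientMethod

/-! ### Absolutely continuous functions -/

section AbsolutelyContinuous

theorem _root_.LipschitzWith.comp_absolutelyContinuousOnInterval {X Y : Type*}
    [PseudoMetricSpace X] [PseudoMetricSpace Y] {C : NNReal} {g : X → Y} (hg : LipschitzWith C g)
    {u : ℝ → X} {a b : ℝ} (hu : AbsolutelyContinuousOnInterval u a b) :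
    AbsolutelyContinuousOnInterval (fun t => g (u t)) a b := by
  have h : Tendsto _ _ _ := Tendsto.const_mul (C : ℝ) hu
  rw [mul_zero] at h
  refine squeeze_zero (fun E => Finset.sum_nonneg fun i _ => dist_nonneg) (fun E => ?_) h
  rw [Finset.mul_sum]
  exact Finset.sum_le_sum fun i _ => hg.dist_le_mul _ _

theorem _root_.AbsolutelyContinuousOnInterval.norm_sq {E : Type*} [NormedAddCommGroup E]
    {u : ℝ → E} {a b : ℝ} (hu : AbsolutelyContinuousOnInterval u a b) :
    AbsolutelyContinuousOnInterval (fun t => ‖u t‖ ^ 2) a b := by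
  have h := lipschitzWith_one_norm.comp_absolutelyContinuousOnInterval hu
  simpa only [pow_two] using h.fun_mul h

theorem _root_.AbsolutelyContinuousOnInterval.const {E : Type*} [NormedAddCommGroup E]
    (c : E) (a b : ℝ) : AbsolutelyContinuousOnInterval (fun _ => c) a b :=
  ((LipschitzWith.const c).lipschitzOnWith).absolutelyContinuousOnInterval

theorem _root_.AbsolutelyContinuousOnInterval.comp_const_add {E : Type*} [NormedAddCommGroup E]
    [NormedSpace ℝ E] {u : ℝ → E} {a b s : ℝ} (hu : AbsolutelyContinuousOnInterval u (s + a) (s + b)) :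
    AbsolutelyContinuousOnInterval (fun t => u (s + t)) a b := by
  rw [absolutelyContinuousOnInterval_iff] at hu ⊢
  intro ε hε
  obtain ⟨δ, hδ, h⟩ := hu ε hε
  refine ⟨δ, hδ, fun E hE hEδ => ?_⟩
  refine h (E.1, fun i => (s + (E.2 i).1, s + (E.2 i).2)) ⟨?_, ?_⟩ ?_
  · intro i hi
    have := hE.1 i hi
    simp only [← image_const_add_uIcc]
    exact ⟨mem_image_of_mem _ this.1, mem_image_of_mem _ this.2⟩
  · intro i hi j hj hij
    have := hE.2 hi hj hij
    simp only [Function.onFun, uIoc, min_add_add_left, max_add_add_left,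
      ← image_const_add_Ioc] at this ⊢
    exact (disjoint_image_iff (add_right_injective s)).2 this
  · simpa using hEδ

theorem _root_.AbsolutelyContinuousOnInterval.le_of_ae_hasDerivAt_nonpos {g : ℝ → ℝ} {a b : ℝ}
    (hab : a ≤ b) (hg : AbsolutelyContinuousOnInterval g a b)
    (h : ∀ᵐ t, t ∈ Icc a b → ∃ c ≤ 0, HasDerivAt g c t) : g b ≤ g a := by
  have h1 := hg.integral_deriv_eq_sub
  have h2 : ∫ t in a..b, deriv g t ≤ 0 := by
    rw [intervalIntegral.integral_of_le hab]
    refine integral_nonpos_of_ae ?_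
    rw [Filter.EventuallyLE, ae_restrict_iff' measurableSet_Ioc]
    filter_upwards [h] with t ht htm
    obtain ⟨c, hc, hd⟩ := ht (Ioc_subset_Icc_self htm)
    simpa [hd.deriv] using hc
  linarith

end AbsolutelyContinuous

/-! ### Convex geometry -/

section Convexity

/-- The line through `p` and `u` stays in the affine span, where `s` is a neighbourhood of `p`. -/
theorem exists_sub_smul_mem_of_mem_intrinsicInterior {E : Type*} [NormedAddCommGroup E]
    [NormedSpace ℝ E] {s : Set E} {p u : E} (hp : p ∈ intrinsicInterior ℝ s) (hu : u ∈ s) :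
    ∃ c > (0 : ℝ), p - c • (u - p) ∈ s := by
  obtain ⟨y, hy, rfl⟩ := mem_intrinsicInterior.1 hp
  let u' : affineSpan ℝ s := ⟨u, subset_affineSpan ℝ s hu⟩
  have hmem : ∀ c : ℝ, (y : E) - c • (u - y) ∈ affineSpan ℝ s := fun c => by
    have := AffineMap.lineMap_mem (-c) y.2 u'.2
    rw [AffineMap.lineMap_apply] at this
    convert this using 1
    simp [u']; abel
  let γ : ℝ → affineSpan ℝ s := fun c => ⟨(y : E) - c • (u - y), hmem c⟩
  have hγ : Continuous γ := by
    refine Continuous.subtype_mk ?_ _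
    fun_prop
  have hγ0 : γ 0 = y := by ext; simp [γ]
  have hev : ∀ᶠ c in 𝓝 (0 : ℝ), γ c ∈ ((↑) ⁻¹' s : Set (affineSpan ℝ s)) := by
    refine hγ.continuousAt.eventually ?_
    rw [hγ0]
    exact mem_interior_iff_mem_nhds.1 hy
  obtain ⟨c, hc, hc0⟩ := ((hev.filter_mono nhdsWithin_le_nhds).and
    (self_mem_nhdsWithin : Ioi (0 : ℝ) ∈ 𝓝[>] 0)).exists
  exact ⟨c, hc0, hc⟩

/-- If `q` is not beyond any supporting hyperplane of `X`, then segments from points of `X` to `q`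
can be prolonged inside a convex set `K` that contains `X` and `q`. -/
theorem exists_sub_smul_mem_of_supporting {E : Type*} [NormedAddCommGroup E]
    [InnerProductSpace ℝ E] [FiniteDimensional ℝ E] {K X : Set E} (hK : Convex ℝ K) {q : E}
    (hq : q ∈ K) (hX : X ⊆ K)
    (h : ∀ c : E, (∀ x ∈ X, 0 ≤ inner ℝ c (x - q)) → ∀ x ∈ X, inner ℝ c (x - q) = 0)
    {x : E} (hx : x ∈ X) : ∃ c > (0 : ℝ), q - c • (x - q) ∈ K := by
  set W : Submodule ℝ E := Submodule.span ℝ ((fun x => x - q) '' X) with hW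
  -- The slice of `K - q` by `W`, thickened by `Wᗮ`. Since it spans the whole space it has interior
  -- points, and separation applies without relative interiors.
  set T : Set E := {e | q + W.starProjection e ∈ K} with hT
  have hTconv : Convex ℝ T := by
    intro e he e' he' a b ha hb hab
    have := hK he he' ha hb hab
    simp only [hT, mem_ofPred_eq, map_add, map_smul]
    convert this using 1
    rw [smul_add, smul_add, add_add_add_comm, ← add_smul, hab, one_smul]
  have hXW : ∀ x ∈ X, x - q ∈ W := fun x hx => Submodule.subset_span ⟨x, hx, rfl⟩
  have hXT : ∀ x ∈ X, x - q ∈ T := fun x hx => by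
    simp only [hT, mem_ofPred_eq, Submodule.starProjection_eq_self_iff.2 (hXW x hx)]
    simpa using hX hx
  have hWT : ∀ e ∈ Wᗮ, e ∈ T := fun e he => by
    simp only [hT, mem_ofPred_eq, (W.starProjection_apply_eq_zero_iff).2 he]
    simpa using hq
  have h0T : (0 : E) ∈ T := hWT 0 (zero_mem _)
  have hspan : affineSpan ℝ T = ⊤ := by
    rw [AffineSubspace.affineSpan_eq_top_iff_vectorSpan_eq_top_of_nonempty _ _ _ ⟨0, h0T⟩,
      vectorSpan_eq_span_vsub_set_right ℝ h0T, eq_top_iff, ← Submodule.sup_orthogonal_of_hasOrthogonalProjection (K := W)]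
    simp only [vsub_eq_sub, sub_zero, image_id']
    refine sup_le ?_ fun e he => Submodule.subset_span (hWT e he)
    rw [hW, Submodule.span_le]
    rintro _ ⟨x, hx, rfl⟩
    exact Submodule.subset_span (hXT x hx)
  have hne := hTconv.interior_nonempty_iff_affineSpan_eq_top.2 hspan
  have h0 : (0 : E) ∈ interior T := by
    by_contra hcon
    obtain ⟨f, hf⟩ := geometric_hahn_banach_open_point hTconv.interior isOpen_interior hcon
    rw [map_zero] at hf
    have hle : ∀ e ∈ T, f e ≤ 0 := by
      intro e he
      have : e ∈ closure (interior T) := by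
        rw [hTconv.closure_interior_eq_closure_of_nonempty_interior hne]
        exact subset_closure he
      exact closure_minimal (fun a ha => (hf a ha).le) (isClosed_le f.continuous continuous_const) this
    have hperp : ∀ e ∈ Wᗮ, f e = 0 := fun e he => by
      have h1 := hle e (hWT e he)
      have h2 := hle (-e) (hWT _ (neg_mem he))
      rw [map_neg] at h2
      linarith
    set c := (InnerProductSpace.toDual ℝ E).symm f with hc
    have hcf : ∀ e, inner ℝ c e = f e := fun e => by simp [hc]
    have hXz : ∀ x ∈ X, f (x - q) = 0 := by
      have := h (-c) fun x hx => by
        rw [inner_neg_left, hcf]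
        linarith [hle _ (hXT x hx)]
      intro x hx
      have h1 := this x hx
      rw [inner_neg_left, hcf] at h1
      linarith
    have hWz : W ≤ LinearMap.ker (f : E →ₗ[ℝ] ℝ) := by
      rw [hW, Submodule.span_le]
      rintro _ ⟨x, hx, rfl⟩
      exact hXz x hx
    -- `f` vanishes on `W` and on `Wᗮ`, yet it is negative on the nonempty interior of `T`.
    obtain ⟨a, ha⟩ := hne
    have hfa := hf a ha
    have e1 : f a = f (W.starProjection a) + f (a - W.starProjection a) := by
      rw [← map_add]; congr 1; abel
    have e2 : f (W.starProjection a) = 0 := hWz (Submodule.starProjection_apply_mem _ _)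
    rw [e1, e2, hperp _ (Submodule.sub_starProjection_mem_orthogonal _)] at hfa
    simp at hfa
  have hev : ∀ᶠ c in 𝓝 (0 : ℝ), (-c) • (x - q) ∈ T := by
    have hcont : Continuous fun c : ℝ => (-c) • (x - q) := by fun_prop
    refine hcont.continuousAt.eventually ?_
    simpa using mem_interior_iff_mem_nhds.1 h0
  obtain ⟨c, hc, hc0⟩ := ((hev.filter_mono nhdsWithin_le_nhds).and
    (self_mem_nhdsWithin : Ioi (0 : ℝ) ∈ 𝓝[>] 0)).exists
  refine ⟨c, hc0, ?_⟩
  simp only [hT, mem_ofPred_eq, map_smul, Submodule.starProjection_eq_self_iff.2 (hXW x hx)] at hc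
  convert hc using 1
  rw [neg_smul, sub_eq_add_neg]

end Convexity

/-- A nonnegative continuous function with relatively dense almost periods and vanishing lower mean
is zero. -/
theorem eq_zero_of_almostPeriodic {g : ℝ → ℝ} (hg : Continuous g) (hg0 : ∀ t, 0 ≤ t → 0 ≤ g t)
    (hper : ∀ ε > 0, ∃ L ≥ 0, ∀ a ≥ 0, ∃ h ∈ Icc a (a + L), ∀ t ≥ 0, |g (t + h) - g t| ≤ ε)
    (hmean : ∀ ε > 0, ∀ M : ℝ, ∃ T ≥ M, ∫ t in 0..T, g t ≤ ε * T) {t₁ : ℝ} (ht₁ : 0 ≤ t₁) :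
    g t₁ = 0 := by
  by_contra hne
  have hpos : 0 < g t₁ := lt_of_le_of_ne (hg0 t₁ ht₁) (Ne.symm hne)
  -- Near `t₁` the function is at least 2δ; translating by a δ-almost period still leaves δ.
  set δ := g t₁ / 4 with hδ
  have hδ0 : 0 < δ := by positivity
  obtain ⟨η, hη0, hη⟩ : ∃ η > 0, ∀ t ∈ Icc t₁ (t₁ + η), 2 * δ ≤ g t := by
    have : ∀ᶠ t in 𝓝 t₁, 2 * δ < g t := hg.continuousAt.eventually_const_lt (by linarith)
    obtain ⟨η, hη, h⟩ := Metric.eventually_nhds_iff.1 this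
    refine ⟨η / 2, by positivity, fun t ht => (h ?_).le⟩
    rw [Real.dist_eq, abs_of_nonneg (by linarith [ht.1])]
    linarith [ht.2]
  obtain ⟨L, hL0, hL⟩ := hper δ hδ0
  -- Every window [a, a + M] contains a translate of [t₁, t₁ + η] by an almost period.
  set M := L + t₁ + η with hM
  have hM0 : 0 < M := by positivity
  have hint : ∀ a b, IntervalIntegrable g volume a b := fun a b => hg.intervalIntegrable a b
  have hnn : ∀ a b, 0 ≤ a → a ≤ b → 0 ≤ ∫ t in a..b, g t := fun a b ha hab =>
    intervalIntegral.integral_nonneg hab fun t ht => hg0 t (ha.trans ht.1)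
  have hblock : ∀ a ≥ 0, η * δ ≤ ∫ t in a..(a + M), g t := by
    intro a ha
    obtain ⟨h, hh, hgh⟩ := hL a ha
    have h1 : η * δ ≤ ∫ t in (t₁ + h)..(t₁ + h + η), g t := by
      have := intervalIntegral.integral_mono_on (μ := volume) (a := t₁ + h) (b := t₁ + h + η)
        (by linarith) (intervalIntegrable_const (c := δ)) (hint _ _) (fun t ht => by
          have h2 := hη (t - h) ⟨by linarith [ht.1], by linarith [ht.2]⟩
          have h3 := abs_le.1 (hgh (t - h) (by linarith [ht.1]))
          rw [sub_add_cancel] at h3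
          linarith [h3.1])
      simpa using this
    have h2 := hnn a (t₁ + h) ha (by linarith [hh.1])
    have h3 := hnn (t₁ + h + η) (a + M) (by linarith [hh.1]) (by linarith [hh.2])
    rw [← intervalIntegral.integral_add_adjacent_intervals (hint a (t₁ + h)) (hint _ (a + M)),
      ← intervalIntegral.integral_add_adjacent_intervals (hint (t₁ + h) (t₁ + h + η))
        (hint _ (a + M))]
    linarith
  have hsum : ∀ k : ℕ, k * (η * δ) ≤ ∫ t in 0..(k * M), g t := by
    intro k
    induction k with
    | zero => simp
    | succ k ih =>
      have h1 := hblock (k * M) (by positivity)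
      rw [← intervalIntegral.integral_add_adjacent_intervals (hint 0 (k * M)) (hint _ _)]
      push_cast
      rw [add_mul (k : ℝ) 1 M, one_mul]
      linarith
  -- With k = ⌊T/M⌋ ≥ 1 the mean bound gives at most ηδ(k+1)/4 < kηδ, against the block sum.
  obtain ⟨T, hT, hTg⟩ := hmean (η * δ / (4 * M)) (by positivity) M
  set k := ⌊T / M⌋₊ with hk
  have hk1 : 1 ≤ k := Nat.le_floor (by rw [Nat.cast_one, le_div_iff₀ hM0]; linarith)
  have hkT : k * M ≤ T := by
    rw [← le_div_iff₀ hM0]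
    exact Nat.floor_le (div_nonneg (hM0.le.trans hT) hM0.le)
  have hTk : T < (k + 1) * M := by
    rw [← div_lt_iff₀ hM0]
    exact Nat.lt_floor_add_one _
  have h1 := hsum k
  have h2 := hnn (k * M) T (by positivity) hkT
  have h3 := intervalIntegral.integral_add_adjacent_intervals (hint 0 (k * M)) (hint (k * M) T)
  have h4 : η * δ / (4 * M) * T ≤ η * δ / (4 * M) * ((k + 1) * M) := by gcongr
  have h5 : η * δ / (4 * M) * ((k + 1) * M) = η * δ * (k + 1) / 4 := by field_simp
  have hk1' : (1 : ℝ) ≤ k := by exact_mod_cast hk1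
  have h6 : 0 < η * δ := by positivity
  nlinarith

/-! ### Monotone fields, Minty's lemma and isotropic vectors -/

section Monotone

variable {E : Type*} [NormedAddCommGroup E] [InnerProductSpace ℝ E]

/-- A monotone field that is orthogonal to the segment joining a solution `p` of the variational
inequality to `z` is affine along this segment, in the interior directions. -/
theorem inner_eq_smul_inner_of_monotone {K : Set E} {f : E → E}
    (hcont : ContinuousOn f K) (hmono : ∀ u ∈ K, ∀ w ∈ K, inner ℝ (f u - f w) (u - w) ≤ 0)
    {p z d : E} {r : ℝ} (hp : p ∈ K) (hpN : ∀ w ∈ K, inner ℝ (f p) (w - p) ≤ 0) (hz : z ∈ K)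
    (hpd : inner ℝ (f p) d = 0)
    (hzp : inner ℝ (f z) (z - p) = 0) (hr : r ∈ Icc (0 : ℝ) 1)
    (hd : ∀ᶠ s in 𝓝 (0 : ℝ), p + r • (z - p) + s • d ∈ K) :
    inner ℝ (f (p + r • (z - p))) d = r * inner ℝ (f z) d := by
  by_cases ha : z - p = 0
  · have : z = p := sub_eq_zero.1 ha
    subst this
    simp [hpd]
  set a := z - p with ha'
  set b := f z with hb
  set c := p + r • a with hc
  have hna : ‖a‖ ^ 2 ≠ 0 := by simpa using ha
  -- A skew map sending `a` to `b`, which exists because `b` is orthogonal to `a`. Subtracting it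
  -- does not affect monotonicity.
  set Λ : E → E := fun w => (‖a‖ ^ 2)⁻¹ • (inner ℝ a w • b - inner ℝ b w • a) with hΛ
  have hskew : ∀ u w, inner ℝ (Λ u - Λ w) (u - w) = 0 := by
    intro u w
    simp only [hΛ, ← smul_sub, inner_smul_left, inner_sub_left, inner_sub_right, RCLike.conj_to_real]
    ring
  have hΛa : ∀ s : ℝ, Λ (s • a) = s • b := by
    intro s
    have h1 : inner ℝ a (s • a) = s * ‖a‖ ^ 2 := by
      rw [inner_smul_right, real_inner_self_eq_norm_sq]
    have h2 : inner ℝ b (s • a) = 0 := by rw [inner_smul_right, hzp, mul_zero]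
    simp only [hΛ, h1, h2, zero_smul, sub_zero, smul_smul]
    congr 1
    field_simp
  have hΛcont : Continuous Λ := by fun_prop
  set N : E → E := fun w => f w - Λ (w - p) with hN
  have hNmono : ∀ u ∈ K, ∀ w ∈ K, inner ℝ (N u - N w) (u - w) ≤ 0 := by
    intro u hu w hw
    have h1 := hskew (u - p) (w - p)
    rw [sub_sub_sub_cancel_right] at h1
    have h2 : N u - N w = (f u - f w) - (Λ (u - p) - Λ (w - p)) := by simp only [hN]; abel
    rw [h2, inner_sub_left, h1, sub_zero]
    exact hmono u hu w hw
  have hNz : N z = 0 := by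
    have := hΛa 1
    rw [one_smul, one_smul] at this
    simp only [hN, ← ha', this, ← hb, sub_self]
  have hNp : N p = f p := by
    have := hΛa 0
    rw [zero_smul, zero_smul] at this
    simp only [hN, sub_self, this, sub_zero]
  have hNc : N c = f c - r • b := by
    have : c - p = r • a := by rw [hc]; abel
    simp only [hN, this, hΛa]
  -- Minty's inequality for `N` holds at `z`, where `N` vanishes, and at `p`. It is affine in the
  -- base point, so it holds at `c`.
  have hkey : ∀ w ∈ K, inner ℝ (N w) (w - c) ≤ 0 := by
    intro w hw
    have h1 := hNmono w hw z hz
    rw [hNz, sub_zero] at h1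
    have h2 := hNmono w hw p hp
    rw [hNp, inner_sub_left] at h2
    have h3 := hpN w hw
    have h4 : w - c = r • (w - z) + (1 - r) • (w - p) := by
      rw [hc, ha']; module
    rw [h4, inner_add_right, inner_smul_right, inner_smul_right]
    have h5 : inner ℝ (N w) (w - p) ≤ 0 := by linarith
    nlinarith [hr.1, hr.2, mul_nonneg hr.1 (neg_nonneg.2 h1),
      mul_nonneg (sub_nonneg.2 hr.2) (neg_nonneg.2 h5)]
  have hcK : c ∈ K := by simpa using hd.self_of_nhds
  have hhalf : ∀ d' : E, (∀ᶠ s in 𝓝 (0 : ℝ), c + s • d' ∈ K) → inner ℝ (N c) d' ≤ 0 := by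
    intro d' hd'
    have hcontN : ContinuousOn N K := hcont.sub (by fun_prop)
    have htend : Tendsto (fun s : ℝ => c + s • d') (𝓝[>] 0) (𝓝[K] c) := by
      refine tendsto_nhdsWithin_iff.2 ⟨?_, hd'.filter_mono nhdsWithin_le_nhds⟩
      have : Continuous fun s : ℝ => c + s • d' := by fun_prop
      simpa using (this.tendsto 0).mono_left nhdsWithin_le_nhds
    have hlim : Tendsto (fun s : ℝ => inner ℝ (N (c + s • d')) d') (𝓝[>] 0) (𝓝 (inner ℝ (N c) d')) :=
      ((hcontN c hcK).tendsto.comp htend).inner tendsto_const_nhds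
    refine le_of_tendsto hlim ?_
    filter_upwards [hd'.filter_mono nhdsWithin_le_nhds, self_mem_nhdsWithin] with s hs hs0
    have := hkey _ hs
    rw [add_sub_cancel_left, inner_smul_right] at this
    exact nonpos_of_mul_nonpos_right this hs0
  have h1 := hhalf d hd
  have h2 := hhalf (-d) (by
    have : Tendsto (fun s : ℝ => -s) (𝓝 0) (𝓝 0) := by simpa using (continuous_neg (G := ℝ)).tendsto 0
    filter_upwards [this.eventually hd] with s hs
    simpa using hs)
  rw [inner_neg_right] at h2
  have h3 : inner ℝ (N c) d = 0 := by linarith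
  rw [hNc, inner_sub_left, inner_smul_left] at h3
  simp only [RCLike.conj_to_real] at h3
  linarith

/-- **Minty's lemma**. -/
theorem minty {K : Set E} (hK : Convex ℝ K) {f : E → E}
    (hcont : ContinuousOn f K) {q : E} (hq : q ∈ K)
    (h : ∀ w ∈ K, inner ℝ (f w) (w - q) ≤ 0) {w : E} (hw : w ∈ K) :
    inner ℝ (f q) (w - q) ≤ 0 := by
  have hseg : ∀ s ∈ Ioo (0 : ℝ) 1, q + s • (w - q) ∈ K := fun s hs =>
    hK.add_smul_sub_mem hq hw ⟨hs.1.le, hs.2.le⟩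
  have hI := Ioo_mem_nhdsGT (zero_lt_one (α := ℝ))
  have htend : Tendsto (fun s : ℝ => q + s • (w - q)) (𝓝[>] 0) (𝓝[K] q) := by
    refine tendsto_nhdsWithin_iff.2 ⟨?_, ?_⟩
    · have : Continuous fun s : ℝ => q + s • (w - q) := by fun_prop
      simpa using (this.tendsto 0).mono_left nhdsWithin_le_nhds
    · filter_upwards [hI] with s hs using hseg s hs
  refine le_of_tendsto (((hcont q hq).tendsto.comp htend).inner tendsto_const_nhds) ?_
  filter_upwards [hI] with s hs
  have := h _ (hseg s hs)
  rw [add_sub_cancel_left, inner_smul_right] at this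
  exact nonpos_of_mul_nonpos_right this hs.1

/-- A symmetric operator that is negative semidefinite on `V` maps its isotropic vectors in `V` to
vectors orthogonal to `V`. -/
theorem inner_eq_zero_of_isotropic {T : E →L[ℝ] E} (hT : ∀ u w, inner ℝ (T u) w = inner ℝ u (T w))
    {V : Submodule ℝ E} (hneg : ∀ d ∈ V, inner ℝ (T d) d ≤ 0) {z d : E} (hz : z ∈ V) (hd : d ∈ V)
    (h0 : inner ℝ (T z) z = 0) : inner ℝ (T z) d = 0 := by
  have key : ∀ s : ℝ, 2 * s * inner ℝ (T z) d + s ^ 2 * inner ℝ (T d) d ≤ 0 := by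
    intro s
    have := hneg (z + s • d) (V.add_mem hz (V.smul_mem s hd))
    simp only [map_add, map_smul, inner_add_left, inner_add_right, inner_smul_left,
      inner_smul_right, RCLike.conj_to_real, h0] at this
    rw [hT d z, real_inner_comm] at this
    nlinarith
  by_contra hne
  set x := inner ℝ (T z) d with hx
  set y := inner ℝ (T d) d with hy
  have hy0 : y ≤ 0 := hneg d hd
  -- Near the optimal -x/y; the denominator 1 - y stays positive when y = 0.
  have h := key (x / (1 - y))
  have h1 : 0 < 1 - y := by linarith
  have h2 : 2 * (x / (1 - y)) * x + (x / (1 - y)) ^ 2 * y = (x / (1 - y)) ^ 2 * (2 - y) := by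
    field_simp; ring
  rw [h2] at h
  have h3 : 0 < (x / (1 - y)) ^ 2 := by positivity
  nlinarith

end Monotone

/-! ### The vector field of a concave-convex function -/

section Field

variable {n m : ℕ} {K U : Set (Z n m)} {φ : Z n m → ℝ}

/-- The sum of the gradient inequalities for the concave φ(·, y) and the convex φ(x, ·) at `z`; the
terms `φ z` cancel. The mixed points need not lie in `K`, and differentiability is used only at `z`.
-/
theorem sub_le_inner_field (hcc : IsConcaveConvexOn K φ) {z w : Z n m} (hz : z ∈ K) (hw : w ∈ K)
    (hd : DifferentiableAt ℝ φ z) :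
    φ (pair (xPart w) (yPart z)) - φ (pair (xPart z) (yPart w)) ≤ inner ℝ (field φ z) (w - z) := by
  have hzx : xPart z ∈ xPart '' K := ⟨z, hz, rfl⟩
  have hzy : yPart z ∈ yPart '' K := ⟨z, hz, rfl⟩
  have hwx : xPart w ∈ xPart '' K := ⟨w, hw, rfl⟩
  have hwy : yPart w ∈ yPart '' K := ⟨w, hw, rfl⟩
  have ex : ∀ t : ℝ, z + t • pair (xPart (w - z)) 0
      = pair ((1 - t) • xPart z + t • xPart w) (yPart z) := by
    intro t
    ext k
    cases k
    · simp [pair, xPart]; ring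
    · simp [pair, yPart]
  have ey : ∀ t : ℝ, z + t • pair 0 (yPart (w - z))
      = pair (xPart z) ((1 - t) • yPart z + t • yPart w) := by
    intro t
    ext k
    cases k
    · simp [pair, xPart]
    · simp [pair, yPart]; ring
  have k1 : φ (pair (xPart w) (yPart z)) - φ z ≤ fderiv ℝ φ z (pair (xPart (w - z)) 0) := by
    refine le_fderiv_of_chord hd fun t ht => ?_
    have := (hcc.1 _ hzy).2 hzx hwx (sub_nonneg.2 ht.2.le) ht.1.le (by ring)
    simp only [pair_xPart_yPart, smul_eq_mul] at this
    rw [ex]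
    linarith
  have k2 : φ z - φ (pair (xPart z) (yPart w))
      ≤ fderiv ℝ (fun w => -φ w) z (pair 0 (yPart (w - z))) := by
    refine le_fderiv_of_chord hd.neg fun t ht => ?_
    have := (hcc.2 _ hzx).2 hzy hwy (sub_nonneg.2 ht.2.le) ht.1.le (by ring)
    simp only [pair_xPart_yPart, smul_eq_mul] at this
    rw [ey]
    linarith
  rw [fderiv_fun_neg] at k2
  simp only [neg_apply] at k2
  rw [inner_field]
  linarith

/-- In the previous bound for (z, w) and for (w, z) the left sides are opposite. -/
theorem field_monotone (hcc : IsConcaveConvexOn K φ) (hd : ∀ z ∈ K, DifferentiableAt ℝ φ z) :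
    ∀ z ∈ K, ∀ w ∈ K, inner ℝ (field φ z - field φ w) (z - w) ≤ 0 := by
  intro z hz w hw
  have h1 := sub_le_inner_field hcc hz hw (hd z hz)
  have h2 := sub_le_inner_field hcc hw hz (hd w hw)
  rw [← neg_sub z w, inner_neg_right] at h1
  rw [inner_sub_left]
  linarith

theorem contDiffOn_partialDeriv (hU : IsOpen U) (hφ : ContDiffOn ℝ 2 φ U) (k : Fin n ⊕ Fin m) :
    ContDiffOn ℝ 1 (partialDeriv φ k) U :=
  (hφ.fderiv_of_isOpen hU (by norm_num)).clm_apply contDiffOn_const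

theorem contDiffOn_field (hU : IsOpen U) (hφ : ContDiffOn ℝ 2 φ U) :
    ContDiffOn ℝ 1 (field φ) U := by
  rw [contDiffOn_euclidean]
  rintro (i | j)
  · exact contDiffOn_partialDeriv hU hφ _
  · exact (contDiffOn_partialDeriv hU hφ _).neg

theorem partialDeriv₂_comm (hU : IsOpen U) (hφ : ContDiffOn ℝ 2 φ U) {z : Z n m} (hz : z ∈ U)
    (k l : Fin n ⊕ Fin m) : partialDeriv₂ φ k l z = partialDeriv₂ φ l k z := by
  have hat : ContDiffAt ℝ 2 φ z := hφ.contDiffAt (hU.mem_nhds hz)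
  have hd : DifferentiableAt ℝ (fderiv ℝ φ) z :=
    (hat.fderiv_right (m := 1) (by norm_num)).differentiableAt one_ne_zero
  have key : ∀ k l : Fin n ⊕ Fin m, partialDeriv₂ φ k l z
      = fderiv ℝ (fderiv ℝ φ) z (EuclideanSpace.single l 1) (EuclideanSpace.single k 1) := by
    intro k l
    have : HasFDerivAt (partialDeriv φ k) _ z := hd.hasFDerivAt.clm_apply (hasFDerivAt_const _ z)
    rw [partialDeriv₂, partialDeriv, this.fderiv]
    simp
  rw [key, key]
  exact (hat.isSymmSndFDerivAt (by simp)).eq _ _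

theorem fderiv_partialDeriv_apply (k : Fin n ⊕ Fin m) (z e : Z n m) :
    fderiv ℝ (partialDeriv φ k) z e = ∑ l, partialDeriv₂ φ k l z * e l := by
  have he : e = ∑ l, e l • (EuclideanSpace.single l (1 : ℝ) : Z n m) := by
    ext k
    cases k <;> simp [Pi.single_apply]
  conv_lhs => rw [he]
  rw [map_sum]
  refine Finset.sum_congr rfl fun l _ => ?_
  rw [map_smul, smul_eq_mul, mul_comm]
  rfl

theorem hasFDerivAt_field (hU : IsOpen U) (hφ : ContDiffOn ℝ 2 φ U) {z : Z n m} (hz : z ∈ U) :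
    HasFDerivAt (field φ) (matA φ z + matB φ z) z := by
  have hd : ∀ k, HasFDerivAt (partialDeriv φ k) (fderiv ℝ (partialDeriv φ k) z) z := fun k =>
    (((contDiffOn_partialDeriv hU hφ k).contDiffAt (hU.mem_nhds hz)).differentiableAt
      one_ne_zero).hasFDerivAt
  rw [← hasFDerivWithinAt_univ, hasFDerivWithinAt_euclidean]
  rintro (i | j)
  · refine ((hd (Sum.inl i)).congr_fderiv ?_).hasFDerivWithinAt
    ext1 e
    rw [fderiv_partialDeriv_apply]
    simp [matA, matB, Matrix.ofLp_toEuclideanCLM, Matrix.mulVec, dotProduct, add_comm]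
  · refine ((hd (Sum.inr j)).neg.congr_fderiv ?_).hasFDerivWithinAt
    ext1 e
    rw [neg_apply, fderiv_partialDeriv_apply]
    simp [matA, matB, Matrix.ofLp_toEuclideanCLM, Matrix.mulVec, dotProduct, add_comm]

theorem inner_toEuclideanCLM {ι : Type*} [Fintype ι] [DecidableEq ι] (M : Matrix ι ι ℝ)
    (u w : EuclideanSpace ℝ ι) :
    inner ℝ (Matrix.toEuclideanCLM (𝕜 := ℝ) M u) w
      = inner ℝ u (Matrix.toEuclideanCLM (𝕜 := ℝ) M.transpose w) := by
  rw [← Matrix.conjTranspose_eq_transpose_of_trivial, ← Matrix.star_eq_conjTranspose, map_star,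
    ContinuousLinearMap.star_eq_adjoint, ContinuousLinearMap.adjoint_inner_right]

/-- Symmetry of second derivatives makes φ_yx the transpose of φ_xy, so A is skew. -/
theorem inner_matA_self (hU : IsOpen U) (hφ : ContDiffOn ℝ 2 φ U) {z : Z n m} (hz : z ∈ U)
    (u : Z n m) : inner ℝ (matA φ z u) u = 0 := by
  have h := inner_toEuclideanCLM (Matrix.fromBlocks
    0 (Matrix.of fun i j => partialDeriv₂ φ (Sum.inl i) (Sum.inr j) z)
    (-Matrix.of fun j i => partialDeriv₂ φ (Sum.inr j) (Sum.inl i) z) 0) u u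
  have hM : (Matrix.fromBlocks
    0 (Matrix.of fun i j => partialDeriv₂ φ (Sum.inl i) (Sum.inr j) z)
    (-Matrix.of fun j i => partialDeriv₂ φ (Sum.inr j) (Sum.inl i) z) 0).transpose =
    -(Matrix.fromBlocks
    0 (Matrix.of fun i j => partialDeriv₂ φ (Sum.inl i) (Sum.inr j) z)
    (-Matrix.of fun j i => partialDeriv₂ φ (Sum.inr j) (Sum.inl i) z) 0) := by
    ext (i | i) (j | j) <;> simp [partialDeriv₂_comm hU hφ hz (Sum.inl _) (Sum.inr _)]
  rw [hM, map_neg, neg_apply, inner_neg_right, real_inner_comm] at h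
  change inner ℝ (Matrix.toEuclideanCLM (𝕜 := ℝ) _ u) u = 0
  rw [real_inner_comm]
  linarith

theorem inner_matB (hU : IsOpen U) (hφ : ContDiffOn ℝ 2 φ U) {z : Z n m} (hz : z ∈ U)
    (u w : Z n m) : inner ℝ (matB φ z u) w = inner ℝ u (matB φ z w) := by
  have hM : (Matrix.fromBlocks
    (Matrix.of fun i i' => partialDeriv₂ φ (Sum.inl i) (Sum.inl i') z) 0
    0 (-Matrix.of fun j j' => partialDeriv₂ φ (Sum.inr j) (Sum.inr j') z)).transpose =
    Matrix.fromBlocks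
    (Matrix.of fun i i' => partialDeriv₂ φ (Sum.inl i) (Sum.inl i') z) 0
    0 (-Matrix.of fun j j' => partialDeriv₂ φ (Sum.inr j) (Sum.inr j') z) := by
    ext (i | i) (j | j) <;> simp
    · exact partialDeriv₂_comm hU hφ hz _ _
    · exact partialDeriv₂_comm hU hφ hz _ _
  rw [matB, inner_toEuclideanCLM, hM]

end Field

/-! ### Faces and restricted saddle points -/

section Face

variable {n m : ℕ} {K S : Set (Z n m)}

theorem subset_minimalFace : S ⊆ minimalFace K S := fun _ hp _ hF => hF.2 hp

theorem minimalFace_subset {F : Set (Z n m)} (hF : IsFace K F) (hS : S ⊆ F) :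
    minimalFace K S ⊆ F := fun _ hu => hu F ⟨hF, hS⟩

theorem isFace_minimalFace (hK : Convex ℝ K) (hS : S ⊆ K) : IsFace K (minimalFace K S) :=
  ⟨convex_sInter fun _ hF => hF.1.1,
    isExtreme_sInter ⟨K, ⟨hK, IsExtreme.refl ℝ K⟩, hS⟩ fun _ hF => hF.1.2⟩

theorem mem_openSegment_of_sub_smul {p u : Z n m} {c : ℝ} (hc : 0 < c) :
    p ∈ openSegment ℝ u (p - c • (u - p)) := by
  refine ⟨c / (1 + c), 1 / (1 + c), by positivity, by positivity, by field_simp; ring, ?_⟩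
  have h : (1 + c) ≠ 0 := by positivity
  have : p = ((1 + c) / (1 + c)) • p := by rw [div_self h, one_smul]
  conv_rhs => rw [this]
  simp only [div_eq_inv_mul, mul_smul, ← smul_add]
  congr 1
  module

/-- The points of `K` whose segments to `p` can be prolonged inside `K` form a face. -/
theorem isFace_setOf_exists_sub_smul_mem (hK : Convex ℝ K) {p : Z n m} (hp : p ∈ K) :
    IsFace K {u | u ∈ K ∧ ∃ c > (0 : ℝ), p - c • (u - p) ∈ K} := by
  have hshrink : ∀ (u : Z n m) (c c' : ℝ), 0 < c → 0 < c' → c' ≤ c → p - c • (u - p) ∈ K →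
      p - c' • (u - p) ∈ K := by
    intro u c c' hc hc' hle hu
    have := hK.add_smul_sub_mem hp hu (t := c' / c) ⟨by positivity, (div_le_one hc).2 hle⟩
    convert this using 1
    have h : c' = c' / c * c := by field_simp
    conv_lhs => rw [h]
    module
  refine ⟨?_, fun u hu => hu.1, ?_⟩
  · rintro u ⟨hu, c, hc, hcu⟩ v ⟨hv, c', hc', hcv⟩ a b ha hb hab
    refine ⟨hK hu hv ha hb hab, min c c', lt_min hc hc', ?_⟩
    have h1 := hshrink u c (min c c') hc (lt_min hc hc') (min_le_left _ _) hcu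
    have h2 := hshrink v c' (min c c') hc' (lt_min hc hc') (min_le_right _ _) hcv
    convert hK h1 h2 ha hb hab using 1
    obtain rfl : b = 1 - a := by linarith
    module
  · rintro x hx y hy u ⟨hu, c, hc, hcu⟩ ⟨a, b, ha, hb, hab, rfl⟩
    -- Mixing p - c(u - p) and y with weights 1/(1+cb) and cb/(1+cb) cancels y.
    refine ⟨hx, c * a / (1 + c * b), by positivity, ?_⟩
    have hne : 1 + c * b ≠ 0 := by positivity
    convert hK hcu hy (a := 1 / (1 + c * b)) (b := c * b / (1 + c * b)) (by positivity)
      (by positivity) (by field_simp) using 1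
    obtain rfl : a = 1 - b := by linarith
    have h1 : c * (1 - b) / (1 + c * b) = (1 + c) * (1 / (1 + c * b)) - 1 := by
      field_simp; ring
    have h2 : c * b / (1 + c * b) = 1 - 1 / (1 + c * b) := by
      field_simp; ring
    have h3 : c * b * (1 / (1 + c * b)) = 1 - 1 / (1 + c * b) := by
      field_simp; ring
    rw [h1, h2]
    set e := 1 / (1 + c * b) with he
    have h4 : e • (p - c • ((1 - b) • x + b • y - p)) + (1 - e) • y
        = (e + e * c) • p - (e * c) • x + (c * b * e) • x + (1 - e) • y - (c * b * e) • y := by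
      module
    rw [h4, h3]
    module

/-- The points that can be prolonged through `p` form a face containing `S`, hence containing the
minimal face. The prolonged end stays in the minimal face by extremality, as `p` is inside the
segment. -/
theorem exists_sub_smul_mem_minimalFace (hK : Convex ℝ K)
    (hS : S ⊆ K) {p u : Z n m} (hp : p ∈ S)
    (hpS : ∀ u ∈ S, ∃ c > (0 : ℝ), p - c • (u - p) ∈ K) (hu : u ∈ minimalFace K S) :
    ∃ c > (0 : ℝ), p - c • (u - p) ∈ minimalFace K S := by
  obtain ⟨huK, c, hc, hcu⟩ := minimalFace_subset
    (isFace_setOf_exists_sub_smul_mem hK (hS hp)) (fun u hu => ⟨hS hu, hpS u hu⟩) hu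
  exact ⟨c, hc, (isFace_minimalFace hK hS).2.right_mem_of_mem_openSegment huK hcu
    (subset_minimalFace hp) (mem_openSegment_of_sub_smul hc)⟩

theorem mem_minimalFace_of_sub_smul_mem (hK : Convex ℝ K)
    (hS : S ⊆ K) {p u : Z n m} (hp : p ∈ S) (hu : u ∈ K) {c : ℝ}
    (hc : 0 < c) (hcu : p - c • (u - p) ∈ K) : u ∈ minimalFace K S :=
  (isFace_minimalFace hK hS).2.left_mem_of_mem_openSegment hu hcu
    (subset_minimalFace hp) (mem_openSegment_of_sub_smul hc)

/-- All directions of the span of the minimal face are feasible at its relatively interior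
points. -/
theorem eventually_add_smul_mem_minimalFace (hK : Convex ℝ K)
    (hS : S ⊆ K) {p d : Z n m} (hp : p ∈ S)
    (hpS : ∀ u ∈ S, ∃ c > (0 : ℝ), p - c • (u - p) ∈ K)
    (hd : d ∈ (affineSpan ℝ (minimalFace K S)).direction) :
    ∀ᶠ s in 𝓝 (0 : ℝ), p + s • d ∈ minimalFace K S := by
  have hconv := (isFace_minimalFace hK hS).1
  have hpF : p ∈ minimalFace K S := subset_minimalFace hp
  rw [direction_affineSpan, vectorSpan_eq_span_vsub_set_right ℝ hpF] at hd
  have hmul : ∀ c : ℝ, Tendsto (fun s : ℝ => s * c) (𝓝 0) (𝓝 0) := fun c => by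
    simpa using (continuous_mul_const c).tendsto 0
  induction hd using Submodule.span_induction with
  | mem d hd =>
    obtain ⟨u, hu, rfl⟩ := hd
    obtain ⟨c, hc, hcu⟩ := exists_sub_smul_mem_minimalFace hK hS hp hpS hu
    filter_upwards [Ioo_mem_nhds (neg_lt_zero.2 hc) zero_lt_one] with s hs
    rw [vsub_eq_sub]
    rcases le_total 0 s with h | h
    · exact hconv.add_smul_sub_mem hpF hu ⟨h, hs.2.le⟩
    · have := hconv.add_smul_sub_mem hpF hcu (t := -s / c)
        ⟨div_nonneg (by linarith) hc.le, (div_le_one hc).2 (by linarith [hs.1])⟩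
      convert this using 1
      have h' : s = -(-s / c * c) := by field_simp
      conv_lhs => rw [h']
      module
  | zero => simp [hpF]
  | add a b _ _ ha hb =>
    -- p + s(a + b) is the midpoint of p + 2sa and p + 2sb.
    filter_upwards [(hmul 2).eventually ha, (hmul 2).eventually hb] with s hsa hsb
    convert hconv hsa hsb (a := 1 / 2) (b := 1 / 2) (by norm_num) (by norm_num) (by norm_num) using 1
    module
  | smul c a _ ha =>
    filter_upwards [(hmul c).eventually ha] with s hs
    rwa [smul_smul]

/-- A normal vector at `z` that is orthogonal to the segments from `z` to the points of `S` is
orthogonal to the span of the minimal face containing `S`. -/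
theorem mem_direction_orthogonal_of_normal (hK : Convex ℝ K)
    (hS : S ⊆ K) {p z v : Z n m} (hp : p ∈ S)
    (hv : v ∈ normalCone K z) (h : ∀ u ∈ S, inner ℝ v (u - z) = 0) :
    v ∈ (affineSpan ℝ (minimalFace K S)).directionᗮ := by
  -- The supporting hyperplane with normal `v` cuts `K` in a face; it contains `S`, hence the
  -- minimal face.
  have hface : IsFace K {u | u ∈ K ∧ inner ℝ v (u - z) = 0} := by
    refine ⟨?_, fun u hu => hu.1, ?_⟩
    · rintro a ⟨ha, ha0⟩ b ⟨hb, hb0⟩ s t hs ht hst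
      refine ⟨hK ha hb hs ht hst, ?_⟩
      have : s • a + t • b - z = s • (a - z) + t • (b - z) := by
        obtain rfl : t = 1 - s := by linarith
        module
      rw [this, inner_add_right, inner_smul_right, inner_smul_right, ha0, hb0]
      simp
    · rintro x hx y hy _ ⟨hu, hu0⟩ ⟨s, t, hs, ht, hst, rfl⟩
      refine ⟨hx, le_antisymm (hv x hx) ?_⟩
      have : s • x + t • y - z = s • (x - z) + t • (y - z) := by
        obtain rfl : t = 1 - s := by linarith
        module
      rw [this, inner_add_right, inner_smul_right, inner_smul_right] at hu0
      have h1 := mul_nonneg ht.le (neg_nonneg.2 (hv y hy))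
      have h2 : 0 ≤ s * inner ℝ v (x - z) := by linarith
      exact nonneg_of_mul_nonneg_right h2 hs
  have hsub := minimalFace_subset hface fun u hu => ⟨hS hu, h u hu⟩
  rw [direction_affineSpan, vectorSpan_eq_span_vsub_set_right ℝ (subset_minimalFace hp),
    Submodule.mem_orthogonal]
  intro d hd
  rw [real_inner_comm]
  induction hd using Submodule.span_induction with
  | mem d hd =>
    obtain ⟨u, hu, rfl⟩ := hd
    have : u - p = (u - z) - (p - z) := by abel
    change inner ℝ v (u - p) = 0
    rw [this, inner_sub_right, (hsub hu).2, h p hp, sub_zero]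
  | zero => exact inner_zero_right _
  | add a b _ _ ha hb => rw [inner_add_right, ha, hb, add_zero]
  | smul c a _ ha => rw [inner_smul_right, ha, mul_zero]

end Face

/-! ### Saddle points as solutions of a variational inequality -/

section Saddle

variable {n m : ℕ} {K : Set (Z n m)} {φ : Z n m → ℝ}

/-- For fixed `w` this form is affine in `q`, so it survives convex combinations and limits of time
averages. -/
theorem isRestrictedSaddle_iff_minty (hK : Convex ℝ K) (hcont : ContinuousOn (field φ) K)
    (hmono : ∀ z ∈ K, ∀ w ∈ K, inner ℝ (field φ z - field φ w) (z - w) ≤ 0) {q : Z n m} :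
    IsRestrictedSaddle K φ q ↔ q ∈ K ∧ ∀ w ∈ K, inner ℝ (field φ w) (w - q) ≤ 0 := by
  refine and_congr_right fun hq => ⟨fun h w hw => ?_, fun h w hw => minty hK hcont hq h hw⟩
  have h1 := hmono w hw q hq
  have h2 := h w hw
  rw [inner_sub_left] at h1
  linarith

theorem convex_setOf_isRestrictedSaddle (hK : Convex ℝ K) (hcont : ContinuousOn (field φ) K)
    (hmono : ∀ z ∈ K, ∀ w ∈ K, inner ℝ (field φ z - field φ w) (z - w) ≤ 0) :
    Convex ℝ {z | IsRestrictedSaddle K φ z} := by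
  simp only [isRestrictedSaddle_iff_minty hK hcont hmono]
  rintro p ⟨hp, hp'⟩ q ⟨hq, hq'⟩ a b ha hb hab
  refine ⟨hK hp hq ha hb hab, fun w hw => ?_⟩
  have : w - (a • p + b • q) = a • (w - p) + b • (w - q) := by
    obtain rfl : b = 1 - a := by linarith
    module
  rw [this, inner_add_right, inner_smul_right, inner_smul_right]
  have h1 := mul_nonneg ha (neg_nonneg.2 (hp' w hw))
  have h2 := mul_nonneg hb (neg_nonneg.2 (hq' w hw))
  linarith

/-- ⟨f(p), q - p⟩ and ⟨f(q), p - q⟩ are nonpositive, while monotonicity makes their sum nonnegative.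
-/
theorem field_inner_sub_eq_zero_of_saddle
    (hmono : ∀ z ∈ K, ∀ w ∈ K, inner ℝ (field φ z - field φ w) (z - w) ≤ 0) {p q : Z n m}
    (hp : IsRestrictedSaddle K φ p) (hq : IsRestrictedSaddle K φ q) :
    inner ℝ (field φ p) (q - p) = 0 := by
  have h1 := hmono p hp.1 q hq.1
  have h2 := hp.2 q hq.1
  have h3 := hq.2 p hp.1
  rw [inner_sub_left, ← neg_sub q p, inner_neg_right, inner_neg_right] at h1
  rw [← neg_sub q p, inner_neg_right] at h3
  linarith

end Saddle

/-! ### Trajectories and their limits -/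

theorem _root_.Continuous.absolutelyContinuousOnInterval_integral {E : Type*} [NormedAddCommGroup E]
    [NormedSpace ℝ E] [CompleteSpace E] {g : ℝ → E} (hg : Continuous g) (a b c : ℝ) :
    AbsolutelyContinuousOnInterval (fun t => ∫ s in c..t, g s) a b := by
  refine ContDiffOn.absolutelyContinuousOnInterval (ContDiff.contDiffOn ?_)
  rw [contDiff_one_iff_deriv]
  refine ⟨fun t => (hg.integral_hasStrictDerivAt c t).hasDerivAt.differentiableAt, ?_⟩
  rwa [funext fun t => hg.deriv_integral _ c t]

section Trajectory

variable {n m : ℕ} {K : Set (Z n m)} {φ : Z n m → ℝ} {z w : ℝ → Z n m}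

theorem IsSubgradientTrajectory.shift {I : Set ℝ} (hz : IsSubgradientTrajectory K φ I z) {a : ℝ}
    (ha : Ici a ⊆ I) : IsSubgradientTrajectory K φ (Ici 0) (fun t => z (a + t)) where
  mem t ht := hz.mem _ (ha (by simpa using ht))
  absCont s hs t ht := (hz.absCont _ (ha (by simpa using hs)) _
    (ha (by simpa using ht))).comp_const_add
  ode := by
    have h1 := ae_restrict_of_ae_restrict_of_subset ha hz.ode
    rw [ae_restrict_iff' measurableSet_Ici] at h1 ⊢
    filter_upwards [(measurePreserving_add_left volume a).quasiMeasurePreserving.ae h1] with t ht h0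
    obtain ⟨p, hp, hd⟩ := ht (by simpa using h0)
    exact ⟨p, hp, hd.comp_const_add a t⟩

theorem IsRestrictedSaddle.isSubgradientTrajectory {p : Z n m} (hp : IsRestrictedSaddle K φ p)
    (I : Set ℝ) : IsSubgradientTrajectory K φ I (fun _ => p) where
  mem _ _ := hp.1
  absCont a _ b _ := AbsolutelyContinuousOnInterval.const p a b
  ode := Eventually.of_forall fun t => ⟨field φ p, ⟨hp.2, fun q _ => by simp⟩, by
    simpa using hasDerivAt_const t p⟩

/-- The estimates below use the projection only as some element of the normal cone. Discarding t = 0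
leaves interior times. -/
theorem IsSubgradientTrajectory.ae_hasDerivAt (hz : IsSubgradientTrajectory K φ (Ici 0) z) :
    ∀ᵐ t, 0 ≤ t → 0 < t ∧ ∃ v ∈ normalCone K (z t), HasDerivAt z (field φ (z t) - v) t := by
  have h := hz.ode
  rw [ae_restrict_iff' measurableSet_Ici] at h
  filter_upwards [h, Measure.ae_ne volume (0 : ℝ)] with t ht h0 hpos
  obtain ⟨p, hp, hd⟩ := ht hpos
  exact ⟨lt_of_le_of_ne hpos (Ne.symm h0), p, hp.1, hd⟩

theorem IsSubgradientTrajectory.continuousOn (hz : IsSubgradientTrajectory K φ (Ici 0) z) :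
    ContinuousOn z (Ici 0) := by
  intro t ht
  have ht : 0 ≤ t := ht
  have h := (hz.absCont 0 self_mem_Ici (t + 1) (by simp; linarith)).continuousOn
  rw [uIcc_of_le (by linarith)] at h
  have h1 := h t ⟨ht, by linarith⟩
  refine h1.mono_of_mem_nhdsWithin ?_
  rw [← Ici_inter_Iic]
  exact inter_mem_nhdsWithin _ (Iic_mem_nhds (by linarith))

/-- A trajectory on `[0, ∞)`, extended by a constant. -/
theorem IsSubgradientTrajectory.continuous_comp_max (hz : IsSubgradientTrajectory K φ (Ici 0) z) :
    Continuous fun t => z (max t 0) :=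
  hz.continuousOn.comp_continuous (by fun_prop) fun t => le_max_right t 0

theorem IsSubgradientTrajectory.continuous_field_comp_max
    (hcont : ContinuousOn (field φ) K) (hz : IsSubgradientTrajectory K φ (Ici 0) z) :
    Continuous fun t => field φ (z (max t 0)) :=
  hcont.comp_continuous hz.continuous_comp_max fun t => hz.mem _ (le_max_right t 0)

/-- The subgradient method is nonexpansive. -/
theorem IsSubgradientTrajectory.norm_sub_le
    (hmono : ∀ z ∈ K, ∀ w ∈ K, inner ℝ (field φ z - field φ w) (z - w) ≤ 0)
    (hz : IsSubgradientTrajectory K φ (Ici 0) z) (hw : IsSubgradientTrajectory K φ (Ici 0) w)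
    {s t : ℝ} (hs : 0 ≤ s) (hst : s ≤ t) : ‖z t - w t‖ ≤ ‖z s - w s‖ := by
  have hs' : s ∈ Ici (0 : ℝ) := hs
  have ht' : t ∈ Ici (0 : ℝ) := hs.trans hst
  have hac := ((hz.absCont s hs' t ht').fun_sub (hw.absCont s hs' t ht')).norm_sq
  have h := hac.le_of_ae_hasDerivAt_nonpos hst (by
    filter_upwards [hz.ae_hasDerivAt, hw.ae_hasDerivAt] with r hr hr' hrI
    obtain ⟨-, v, hv, hd⟩ := hr (hs.trans hrI.1)
    obtain ⟨-, v', hv', hd'⟩ := hr' (hs.trans hrI.1)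
    refine ⟨_, ?_, (hd.fun_sub hd').norm_sq⟩
    have hzK := hz.mem r (hs.trans hrI.1)
    have hwK := hw.mem r (hs.trans hrI.1)
    have h1 := hmono _ hzK _ hwK
    have h2 := hv _ hwK
    have h3 := hv' _ hzK
    -- Monotonicity and the two normal cone inequalities make each of the three terms nonpositive.
    have h4 : inner ℝ (z r - w r) (field φ (z r) - v - (field φ (w r) - v'))
        = inner ℝ (field φ (z r) - field φ (w r)) (z r - w r) + inner ℝ v (w r - z r)
          + inner ℝ v' (z r - w r) := by
      rw [real_inner_comm]
      simp only [inner_sub_left, inner_sub_right]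
      ring
    rw [h4]
    linarith)
  exact (sq_le_sq₀ (norm_nonneg _) (norm_nonneg _)).1 h

theorem exists_seq_tendsto_of_mem_omegaLimitSet {p : Z n m} (hp : p ∈ omegaLimitSet K φ) :
    ∃ w, IsSubgradientTrajectory K φ (Ici 0) w ∧ ∃ s : ℕ → ℝ, (∀ k, 0 ≤ s k) ∧
      Tendsto s atTop atTop ∧ Tendsto (fun k => w (s k)) atTop (𝓝 p) := by
  obtain ⟨w, hw, hp⟩ := hp
  simp only [mem_iInter] at hp
  have h : ∀ k : ℕ, ∃ s : ℝ, (k : ℝ) ≤ s ∧ dist (w s) p < 1 / ((k : ℝ) + 1) := by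
    intro k
    obtain ⟨_, ⟨s, hs, rfl⟩, hd⟩ := Metric.mem_closure_iff.1 (hp k (mem_Ici.2 (Nat.cast_nonneg k)))
      (1 / ((k : ℝ) + 1)) (by positivity)
    exact ⟨s, hs, by rwa [dist_comm]⟩
  choose s hs hd using h
  refine ⟨w, hw, s, fun k => (Nat.cast_nonneg k).trans (hs k),
    tendsto_atTop_mono hs tendsto_natCast_atTop_atTop, ?_⟩
  rw [tendsto_iff_dist_tendsto_zero]
  exact squeeze_zero (fun _ => dist_nonneg) (fun k => (hd k).le) tendsto_one_div_add_atTop_nhds_zero_nat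

/-- Limits of time shifts of two trajectories keep a constant distance. -/
theorem norm_sub_eq_of_tendsto_shift
    (hmono : ∀ z ∈ K, ∀ w ∈ K, inner ℝ (field φ z - field φ w) (z - w) ≤ 0)
    {u v : ℝ → Z n m} (hu : IsSubgradientTrajectory K φ (Ici 0) u)
    (hv : IsSubgradientTrajectory K φ (Ici 0) v) {s : ℕ → ℝ} (hs0 : ∀ k, 0 ≤ s k)
    (hs : Tendsto s atTop atTop)
    (hz : ∀ t, 0 ≤ t → Tendsto (fun k => u (s k + t)) atTop (𝓝 (z t)))
    (hw : ∀ t, 0 ≤ t → Tendsto (fun k => v (s k + t)) atTop (𝓝 (w t))) {t : ℝ} (ht : 0 ≤ t) :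
    ‖z t - w t‖ = ‖z 0 - w 0‖ := by
  set a : ℝ → ℝ := fun r => ‖u (max r 0) - v (max r 0)‖ with ha
  have hanti : Antitone a := fun r r' h =>
    hu.norm_sub_le hmono hv (le_max_right r 0) (max_le_max_right 0 h)
  have hlim := tendsto_atTop_ciInf hanti ⟨0, by rintro _ ⟨r, rfl⟩; exact norm_nonneg _⟩
  -- The distance of `u` and `v` is nonincreasing, and its limit is seen at every `r`.
  have key : ∀ r, 0 ≤ r → ‖z r - w r‖ = ⨅ i, a i := by
    intro r hr
    refine tendsto_nhds_unique ((hz r hr).sub (hw r hr)).norm ?_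
    refine (hlim.comp (tendsto_atTop_add_const_right _ r hs)).congr fun k => ?_
    simp only [ha, Function.comp, max_eq_left (add_nonneg (hs0 k) hr)]
  rw [key t ht, key 0 le_rfl]

/-- Nonexpansiveness bounds ‖w(s_k + t) - z(t)‖ by ‖w(s_k) - z(0)‖. -/
theorem tendsto_shift
    (hmono : ∀ z ∈ K, ∀ w ∈ K, inner ℝ (field φ z - field φ w) (z - w) ≤ 0)
    (hw : IsSubgradientTrajectory K φ (Ici 0) w) (hz : IsSubgradientTrajectory K φ (Ici 0) z)
    {s : ℕ → ℝ} (hs0 : ∀ k, 0 ≤ s k) (h : Tendsto (fun k => w (s k)) atTop (𝓝 (z 0)))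
    {t : ℝ} (ht : 0 ≤ t) : Tendsto (fun k => w (s k + t)) atTop (𝓝 (z t)) := by
  rw [tendsto_iff_norm_sub_tendsto_zero] at h ⊢
  refine squeeze_zero (fun _ => norm_nonneg _) (fun k => ?_) h
  simpa using (hw.shift (a := s k) (Ici_subset_Ici.2 (hs0 k))).norm_sub_le hmono hz le_rfl ht

/-- The generating trajectory `w` is compared with its own shift by `h`, then with the constant
trajectory at `p`. -/
theorem norm_sub_eq_of_mem_omegaLimitSet
    (hmono : ∀ z ∈ K, ∀ w ∈ K, inner ℝ (field φ z - field φ w) (z - w) ≤ 0)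
    (hz : IsSubgradientTrajectory K φ (Ici 0) z) (h0 : z 0 ∈ omegaLimitSet K φ) :
    (∀ h, 0 ≤ h → ∀ t, 0 ≤ t → ‖z (t + h) - z t‖ = ‖z h - z 0‖) ∧
    ∀ p, IsRestrictedSaddle K φ p → ∀ t, 0 ≤ t → ‖z t - p‖ = ‖z 0 - p‖ := by
  obtain ⟨w, hw, s, hs0, hs, hws⟩ := exists_seq_tendsto_of_mem_omegaLimitSet h0
  have hlim : ∀ t, 0 ≤ t → Tendsto (fun k => w (s k + t)) atTop (𝓝 (z t)) := fun t ht =>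
    tendsto_shift hmono hw hz hs0 hws ht
  refine ⟨fun h hh t ht => ?_, fun p hp t ht => ?_⟩
  · have := norm_sub_eq_of_tendsto_shift (z := fun t => z (h + t)) (w := z) hmono
      (hw.shift (a := h) (Ici_subset_Ici.2 hh)) hw hs0 hs (fun t ht => by
        simpa only [add_left_comm] using hlim (h + t) (add_nonneg hh ht)) hlim ht
    simpa [add_comm] using this
  · exact norm_sub_eq_of_tendsto_shift (w := fun _ => p) hmono hw
      (hp.isSubgradientTrajectory _) hs0 hs hlim (fun t _ => tendsto_const_nhds) ht

/-- The derivative of ‖z - v‖² is at most 2⟨f(v), z - v⟩; integrate and drop ‖z(T) - v‖². Divided by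
T, this yields Minty's inequality for limits of averages. -/
theorem IsSubgradientTrajectory.neg_norm_sq_le_integral
    (hmono : ∀ z ∈ K, ∀ w ∈ K, inner ℝ (field φ z - field φ w) (z - w) ≤ 0)
    (hz : IsSubgradientTrajectory K φ (Ici 0) z) {v : Z n m} (hv : v ∈ K) {T : ℝ} (hT : 0 ≤ T) :
    -‖z 0 - v‖ ^ 2 ≤ 2 * ∫ t in 0..T, inner ℝ (field φ v) (z (max t 0) - v) := by
  have hc : Continuous fun t => inner ℝ (field φ v) (z (max t 0) - v) :=
    continuous_const.inner (hz.continuous_comp_max.sub continuous_const)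
  have hac := ((hz.absCont 0 self_mem_Ici T hT).fun_sub (.const v 0 T)).norm_sq.fun_sub
    ((hc.absolutelyContinuousOnInterval_integral 0 T 0).const_mul 2)
  have h := hac.le_of_ae_hasDerivAt_nonpos hT (by
    filter_upwards [hz.ae_hasDerivAt] with r hr hrI
    obtain ⟨-, p, hp, hd⟩ := hr hrI.1
    have hzK := hz.mem r hrI.1
    refine ⟨_, ?_, ((hd.fun_sub (hasDerivAt_const r v)).norm_sq).fun_sub
      ((hc.integral_hasStrictDerivAt 0 r).hasDerivAt.const_mul 2)⟩
    have h1 := hmono _ hzK _ hv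
    have h2 := hp _ hv
    have h4 : inner ℝ (z r - v) (field φ (z r) - p - 0)
        = inner ℝ (field φ (z r) - field φ v) (z r - v) + inner ℝ p (v - z r)
          + inner ℝ (field φ v) (z r - v) := by
      rw [real_inner_comm]
      simp only [inner_sub_left, inner_sub_right, sub_zero]
      ring
    rw [h4, max_eq_left hrI.1]
    linarith)
  simp only [intervalIntegral.integral_same] at h
  have := sq_nonneg ‖z T - v‖
  linarith

/-- A bounded trajectory has a restricted saddle point among the limits of its time averages. -/
theorem exists_saddle_mean (hKclosed : IsClosed K) (hK : Convex ℝ K)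
    (hcont : ContinuousOn (field φ) K)
    (hmono : ∀ z ∈ K, ∀ w ∈ K, inner ℝ (field φ z - field φ w) (z - w) ≤ 0)
    (hz : IsSubgradientTrajectory K φ (Ici 0) z) {R : ℝ} (hR : ∀ t, 0 ≤ t → ‖z t‖ ≤ R) :
    ∃ q, IsRestrictedSaddle K φ q ∧ ∀ c : Z n m, ∀ ε > 0, ∀ M : ℝ, ∃ T ≥ M,
      ∫ t in 0..T, inner ℝ c (z (max t 0) - q) ≤ ε * T := by
  have hzc := hz.continuous_comp_max
  set C := K ∩ Metric.closedBall (0 : Z n m) R with hC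
  have hCc : IsCompact C := (isCompact_closedBall _ _).inter_left hKclosed
  have hCconv : Convex ℝ C := hK.inter (convex_closedBall _ _)
  set T : ℕ → ℝ := fun k => (k : ℝ) + 1 with hT
  have hT0 : ∀ k, 0 < T k := fun k => by positivity
  set μ : ℕ → Z n m := fun k => (T k)⁻¹ • ∫ t in 0..(T k), z (max t 0) with hμ
  have hμC : ∀ k, μ k ∈ C := by
    intro k
    have h := hCconv.set_average_mem (μ := volume) (t := Ioc 0 (T k)) (f := fun t => z (max t 0))
      (hCc.isClosed) (by simp [hT0 k]) (by simp)
      (Eventually.of_forall fun t => ⟨hz.mem _ (le_max_right t 0), by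
        simpa using hR _ (le_max_right t 0)⟩)
      ((hzc.integrableOn_Icc (a := 0) (b := T k)).mono_set Ioc_subset_Icc_self)
    rw [setAverage_eq] at h
    simpa [hμ, intervalIntegral.integral_of_le (hT0 k).le, Measure.real, (hT0 k).le] using h
  have hint : ∀ (c v : Z n m) (k : ℕ),
      ∫ t in 0..(T k), inner ℝ c (z (max t 0) - v) = T k * inner ℝ c (μ k - v) := by
    intro c v k
    have h1 : ∫ t in 0..(T k), inner ℝ c (z (max t 0) - v)
        = inner ℝ c (∫ t in 0..(T k), (z (max t 0) - v)) :=
      (innerSL ℝ c).intervalIntegral_comp_comm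
        ((hzc.sub continuous_const).intervalIntegrable 0 (T k))
    rw [h1, intervalIntegral.integral_sub (hzc.intervalIntegrable _ _) intervalIntegrable_const,
      intervalIntegral.integral_const, sub_zero]
    have h2 : ∫ t in 0..(T k), z (max t 0) = T k • μ k := by
      rw [hμ, smul_smul, mul_inv_cancel₀ (hT0 k).ne', one_smul]
    rw [h2, ← smul_sub, inner_smul_right]
  obtain ⟨q, hq, σ, hσ, hlim⟩ := hCc.tendsto_subseq hμC
  have hTσ : Tendsto (fun k => T (σ k)) atTop atTop :=
    tendsto_atTop_add_const_right _ _ (tendsto_natCast_atTop_atTop.comp hσ.tendsto_atTop)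
  have hlim' : ∀ c v : Z n m, Tendsto (fun k => inner ℝ c (μ (σ k) - v)) atTop
      (𝓝 (inner ℝ c (q - v))) := fun c v =>
    tendsto_const_nhds.inner (hlim.sub tendsto_const_nhds)
  refine ⟨q, (isRestrictedSaddle_iff_minty hK hcont hmono).2 ⟨hq.1, fun w hw => ?_⟩, ?_⟩
  · have h1 : Tendsto (fun k => -(‖z 0 - w‖ ^ 2 / 2) / T (σ k)) atTop (𝓝 0) :=
      tendsto_const_nhds.div_atTop hTσ
    have h2 : 0 ≤ inner ℝ (field φ w) (q - w) := by
      refine le_of_tendsto_of_tendsto' h1 (hlim' (field φ w) w) fun k => ?_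
      rw [div_le_iff₀ (hT0 _)]
      have h3 := hz.neg_norm_sq_le_integral hmono hw (hT0 (σ k)).le
      rw [hint] at h3
      linarith
    rw [← neg_sub, inner_neg_right]
    linarith
  · intro c ε hε M
    have h1 := hlim' c q
    rw [sub_self, inner_zero_right] at h1
    obtain ⟨k, hk, hk'⟩ := ((h1.eventually_le_const hε).and (hTσ.eventually_ge_atTop M)).exists
    refine ⟨T (σ k), hk', ?_⟩
    rw [hint, mul_comm]
    exact mul_le_mul_of_nonneg_right hk (hT0 _).le

/-- A bounded curve whose time shifts keep a constant distance has relatively dense almost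
periods. -/
theorem exists_almostPeriod {R : ℝ} (hR : ∀ t, 0 ≤ t → ‖z t‖ ≤ R)
    (hiso : ∀ h, 0 ≤ h → ∀ t, 0 ≤ t → ‖z (t + h) - z t‖ = ‖z h - z 0‖) {ε : ℝ} (hε : 0 < ε) :
    ∃ L ≥ (0 : ℝ), ∀ a ≥ 0, ∃ h ∈ Icc a (a + L), ∀ t ≥ 0, ‖z (t + h) - z t‖ ≤ ε := by
  have hb : TotallyBounded (z '' Ici 0) :=
    (isCompact_closedBall (0 : Z n m) R).totallyBounded.subset (by
      rintro _ ⟨t, ht, rfl⟩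
      simpa using hR t ht)
  obtain ⟨Y, hY, hYfin, hcov⟩ := Metric.finite_approx_of_totallyBounded hb ε hε
  have hY' : ∀ y ∈ Y, ∃ s : ℝ, 0 ≤ s ∧ z s = y := fun y hy => hY hy
  choose! τ hτ0 hτ using hY'
  obtain ⟨L, hL⟩ := (hYfin.image τ).bddAbove
  refine ⟨max L 0, le_max_right _ _, fun a ha => ?_⟩
  have hs : a + max L 0 ∈ Ici (0 : ℝ) := add_nonneg ha (le_max_right _ _)
  obtain ⟨y, hy, hyd⟩ := mem_iUnion₂.1 (hcov (mem_image_of_mem z hs))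
  have h0 : 0 ≤ τ y := hτ0 y hy
  have h1 : τ y ≤ max L 0 := (hL (mem_image_of_mem τ hy)).trans (le_max_left _ _)
  -- The point at time a + max L 0 is ε-close to a net point z(τ y). The difference of the two times
  -- is an almost period, since the displacement does not depend on the starting time.
  refine ⟨a + max L 0 - τ y, ⟨by linarith, by linarith⟩, fun t ht => ?_⟩
  have hh : 0 ≤ a + max L 0 - τ y := by linarith
  rw [hiso _ hh t ht, ← hiso _ hh (τ y) h0, add_sub_cancel, hτ y hy, ← dist_eq_norm]
  exact (Metric.mem_ball.1 hyd).le

/-- Trajectories in the limit set stay in the minimal face containing the saddle points. -/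
theorem mem_minimalFace_of_mem_omegaLimitSet (hKclosed : IsClosed K) (hK : Convex ℝ K)
    (hcont : ContinuousOn (field φ) K)
    (hmono : ∀ z ∈ K, ∀ w ∈ K, inner ℝ (field φ z - field φ w) (z - w) ≤ 0)
    (hsad : IsRestrictedSaddle K φ 0) (hz : IsSubgradientTrajectory K φ (Ici 0) z)
    (h0 : z 0 ∈ omegaLimitSet K φ) {t : ℝ} (ht : 0 ≤ t) :
    z t ∈ minimalFace K {p | IsRestrictedSaddle K φ p} := by
  obtain ⟨hiso, hnorm⟩ := norm_sub_eq_of_mem_omegaLimitSet hmono hz h0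
  have hR : ∀ t, 0 ≤ t → ‖z t‖ ≤ ‖z 0‖ := fun t ht => by simpa using (hnorm 0 hsad t ht).le
  obtain ⟨q, hq, hmean⟩ := exists_saddle_mean hKclosed hK hcont hmono hz hR
  have hsub : z '' Ici 0 ⊆ K := by
    rintro _ ⟨t, ht, rfl⟩
    exact hz.mem t ht
  -- A functional supporting the orbit at `q` is almost periodic with vanishing lower mean, hence
  -- zero on it.
  obtain ⟨c, hc, hcu⟩ := exists_sub_smul_mem_of_supporting hK hq.1 hsub (fun c hc => by
    rintro _ ⟨s, hs, rfl⟩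
    have hs : 0 ≤ s := hs
    have := eq_zero_of_almostPeriodic (g := fun t => inner ℝ c (z (max t 0) - q))
      (continuous_const.inner (hz.continuous_comp_max.sub continuous_const))
      (fun t ht => hc _ ⟨max t 0, le_max_right t 0, rfl⟩) (fun ε hε => by
        obtain ⟨L, hL, h⟩ := exists_almostPeriod hR hiso (ε := ε / (‖c‖ + 1)) (by positivity)
        refine ⟨L, hL, fun a ha => ?_⟩
        obtain ⟨p, hp, hpt⟩ := h a ha
        refine ⟨p, hp, fun t ht => ?_⟩
        rw [← inner_sub_right, sub_sub_sub_cancel_right, max_eq_left ht,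
          max_eq_left (add_nonneg ht (ha.trans hp.1))]
        calc |inner ℝ c (z (t + p) - z t)| ≤ ‖c‖ * ‖z (t + p) - z t‖ := abs_real_inner_le_norm _ _
          _ ≤ (‖c‖ + 1) * (ε / (‖c‖ + 1)) := by
            gcongr
            · linarith
            · exact hpt t ht
          _ = ε := by field_simp) (hmean c) hs
    simpa only [max_eq_left hs] using this) (mem_image_of_mem z ht)
  exact mem_minimalFace_of_sub_smul_mem hK (fun p hp => hp.1) hq (hz.mem t ht) hc hcu

/-- Along a trajectory in the limit set the monotonicity inequalities with saddle points are
equalities. -/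
theorem ae_inner_eq_zero_of_mem_omegaLimitSet
    (hmono : ∀ z ∈ K, ∀ w ∈ K, inner ℝ (field φ z - field φ w) (z - w) ≤ 0)
    (hz : IsSubgradientTrajectory K φ (Ici 0) z) (h0 : z 0 ∈ omegaLimitSet K φ) :
    ∀ᵐ t, 0 ≤ t → 0 < t ∧ ∃ v ∈ normalCone K (z t), HasDerivAt z (field φ (z t) - v) t ∧
      ∀ p, IsRestrictedSaddle K φ p →
        inner ℝ (field φ (z t)) (z t - p) = 0 ∧ inner ℝ v (p - z t) = 0 := by
  have hnorm := (norm_sub_eq_of_mem_omegaLimitSet hmono hz h0).2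
  filter_upwards [hz.ae_hasDerivAt] with t ht ht0
  obtain ⟨hpos, v, hv, hd⟩ := ht ht0
  refine ⟨hpos, v, hv, hd, fun p hp => ?_⟩
  have hzK := hz.mem t ht0
  have h1 := (hd.fun_sub (hasDerivAt_const t p)).norm_sq
  have h2 : HasDerivAt (fun s => ‖z s - p‖ ^ 2) 0 t := by
    refine (hasDerivAt_const t (‖z 0 - p‖ ^ 2)).congr_of_eventuallyEq ?_
    filter_upwards [lt_mem_nhds hpos] with s hs
    rw [hnorm p hp s hs.le]
  have h3 := h1.unique h2
  rw [sub_zero, real_inner_comm, inner_sub_left] at h3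
  -- ⟨f(z), z - p⟩ and ⟨v, p - z⟩ are both nonpositive and add up to zero.
  have h4 := hmono _ hzK _ hp.1
  have h5 := hp.2 _ hzK
  have h6 := hv _ hp.1
  rw [inner_sub_left] at h4
  rw [← neg_sub (z t) p, inner_neg_right] at h6 ⊢
  constructor <;> linarith

theorem inner_field_eq_zero_of_mem_omegaLimitSet (hcont : ContinuousOn (field φ) K)
    (hmono : ∀ z ∈ K, ∀ w ∈ K, inner ℝ (field φ z - field φ w) (z - w) ≤ 0)
    (hz : IsSubgradientTrajectory K φ (Ici 0) z) (h0 : z 0 ∈ omegaLimitSet K φ) {p : Z n m}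
    (hp : IsRestrictedSaddle K φ p) {t : ℝ} (ht : 0 ≤ t) :
    inner ℝ (field φ (z t)) (z t - p) = 0 := by
  have hc : ContinuousOn (fun t => inner ℝ (field φ (z t)) (z t - p)) (Ici 0) :=
    (hcont.comp hz.continuousOn fun t ht => hz.mem t ht).inner
      (hz.continuousOn.sub continuousOn_const)
  refine Measure.eqOn_of_ae_eq (μ := volume) (g := fun _ => (0 : ℝ)) ?_ hc continuousOn_const
    (by simp) ht
  rw [Filter.EventuallyEq, ae_restrict_iff' measurableSet_Ici]
  filter_upwards [ae_inner_eq_zero_of_mem_omegaLimitSet hmono hz h0] with t h ht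
  obtain ⟨-, v, -, -, h⟩ := h ht
  exact (h p hp).1

theorem projPi_eq : projPi K φ = (saddleSpan K φ).direction.starProjection := by
  simp only [projPi, Submodule.orthogonal_orthogonal]

/-- Trajectories in the limit set solve the smooth ODE on the span of the minimal face. -/
theorem hasDerivWithinAt_of_mem_omegaLimitSet (hKclosed : IsClosed K) (hK : Convex ℝ K)
    (hcont : ContinuousOn (field φ) K)
    (hmono : ∀ z ∈ K, ∀ w ∈ K, inner ℝ (field φ z - field φ w) (z - w) ≤ 0)
    (hsad : IsRestrictedSaddle K φ 0) (hz : IsSubgradientTrajectory K φ (Ici 0) z)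
    (h0 : z 0 ∈ omegaLimitSet K φ) {t : ℝ} (ht : 0 ≤ t) :
    HasDerivWithinAt z (projPi K φ (field φ (z t))) (Ici 0) t := by
  set D := (saddleSpan K φ).direction with hD
  have h0F : (0 : Z n m) ∈ saddleSpan K φ := subset_affineSpan ℝ _ (subset_minimalFace hsad)
  have hzD : ∀ t, 0 ≤ t → z t ∈ D := fun t ht => by
    have h := AffineSubspace.vsub_mem_direction (subset_affineSpan ℝ _
      (mem_minimalFace_of_mem_omegaLimitSet hKclosed hK hcont hmono hsad hz h0 ht)) h0F
    rwa [vsub_eq_sub, sub_zero] at h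
  have hgc : Continuous fun t => projPi K φ (field φ (z (max t 0))) :=
    (projPi K φ).continuous.comp (hz.continuous_field_comp_max hcont)
  -- z - G is absolutely continuous with zero derivative almost everywhere, hence constant. As `G`
  -- is C¹, the equation then holds at every time.
  set G : ℝ → Z n m := fun t => ∫ s in 0..t, projPi K φ (field φ (z (max s 0))) with hG
  have hGd : ∀ t, HasDerivAt G (projPi K φ (field φ (z (max t 0)))) t := fun t =>
    (hgc.integral_hasStrictDerivAt 0 t).hasDerivAt
  have hderiv : ∀ᵐ t, 0 ≤ t → HasDerivAt z (projPi K φ (field φ (z (max t 0)))) t := by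
    filter_upwards [ae_inner_eq_zero_of_mem_omegaLimitSet hmono hz h0] with t h ht
    obtain ⟨hpos, v, hv, hd, hp⟩ := h ht
    have hvD : v ∈ Dᗮ := mem_direction_orthogonal_of_normal hK (fun p hp => hp.1) hsad hv
      fun p hps => (hp p hps).2
    have h1 : HasDerivAt (fun s => D.starProjection (z s)) (D.starProjection (field φ (z t) - v)) t :=
      D.starProjection.hasFDerivAt.comp_hasDerivAt t hd
    -- The projection fixes the trajectory, which lies in `D`, and kills `v`.
    have h2 : HasDerivAt z (D.starProjection (field φ (z t) - v)) t := by
      refine h1.congr_of_eventuallyEq ?_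
      filter_upwards [lt_mem_nhds hpos] with s hs
      rw [Submodule.starProjection_eq_self_iff.2 (hzD s hs.le)]
    rw [map_sub, D.starProjection_apply_eq_zero_iff.2 hvD, sub_zero] at h2
    rwa [projPi_eq, max_eq_left ht]
  have hconst : ∀ s, 0 ≤ s → z s = z 0 + G s := by
    intro s hs
    have hac := (hz.absCont 0 self_mem_Ici s hs).fun_sub
      (hgc.absolutelyContinuousOnInterval_integral 0 s 0)
    obtain ⟨C, hC⟩ := hac.const_of_ae_hasDerivAt_zero (by
      filter_upwards [hderiv] with r hr hrI
      rw [uIcc_of_le hs] at hrI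
      simpa using (hr hrI.1).fun_sub (hGd r))
    have h1 := hC s right_mem_uIcc
    have h2 := hC 0 left_mem_uIcc
    simp only [intervalIntegral.integral_same, sub_zero] at h2
    rw [h2, ← h1]
    simp [hG]
  have h := ((hGd t).const_add (z 0)).hasDerivWithinAt (s := Ici 0)
  rw [max_eq_left ht] at h
  exact h.congr (fun s hs => hconst s hs) (hconst t ht)

end Trajectory

/-! ### The field on the minimal face -/

section Linear

variable {n m : ℕ} {K U : Set (Z n m)} {φ : Z n m → ℝ}

/-- The saddle point 0 may lie on the relative boundary of F, where directions of V can be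
infeasible. A relatively interior point of the convex set of saddle points avoids this. -/
theorem exists_saddle_relativeInterior (hK : Convex ℝ K) (hcont : ContinuousOn (field φ) K)
    (hmono : ∀ z ∈ K, ∀ w ∈ K, inner ℝ (field φ z - field φ w) (z - w) ≤ 0)
    (hsad : IsRestrictedSaddle K φ 0) :
    ∃ p, IsRestrictedSaddle K φ p ∧ ∀ d ∈ (saddleSpan K φ).direction,
      ∀ᶠ s in 𝓝 (0 : ℝ), p + s • d ∈ K := by
  obtain ⟨p, hp⟩ := Set.Nonempty.intrinsicInterior
    (convex_setOf_isRestrictedSaddle hK hcont hmono) ⟨0, hsad⟩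
  have hpS : p ∈ {q | IsRestrictedSaddle K φ q} := intrinsicInterior_subset hp
  have hS : {q | IsRestrictedSaddle K φ q} ⊆ K := fun q hq => hq.1
  refine ⟨p, hpS, fun d hd => ?_⟩
  refine (eventually_add_smul_mem_minimalFace hK hS hpS (fun u hu => ?_) hd).mono
    fun s hs => (isFace_minimalFace hK hS).2.subset hs
  obtain ⟨c, hc, hcu⟩ := exists_sub_smul_mem_of_mem_intrinsicInterior hp hu
  exact ⟨c, hc, hS hcu⟩

theorem field_mem_direction_orthogonal (hK : Convex ℝ K)
    (hmono : ∀ z ∈ K, ∀ w ∈ K, inner ℝ (field φ z - field φ w) (z - w) ≤ 0) {p : Z n m}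
    (hp : IsRestrictedSaddle K φ p) : field φ p ∈ (saddleSpan K φ).directionᗮ :=
  mem_direction_orthogonal_of_normal hK (fun _ hq => hq.1) hp hp.2 fun _ hu =>
    field_inner_sub_eq_zero_of_saddle hmono hp hu

/-- On rays from the saddle point `0` the tangential part of the field is linear. -/
theorem inner_field_smul (hK : Convex ℝ K) (hcont : ContinuousOn (field φ) K)
    (hmono : ∀ z ∈ K, ∀ w ∈ K, inner ℝ (field φ z - field φ w) (z - w) ≤ 0)
    (hsad : IsRestrictedSaddle K φ 0) {z : Z n m} (hz : z ∈ K)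
    (hzp : ∀ p, IsRestrictedSaddle K φ p → inner ℝ (field φ z) (z - p) = 0)
    {d : Z n m} (hd : d ∈ (saddleSpan K φ).direction) {r : ℝ} (hr : r ∈ Icc (0 : ℝ) 1) :
    inner ℝ (field φ (r • z)) d = r * inner ℝ (field φ z) d := by
  rcases hr.2.eq_or_lt with rfl | hr1
  · simp
  obtain ⟨p, hp, hpd⟩ := exists_saddle_relativeInterior hK hcont hmono hsad
  have hI := Ioo_mem_nhdsGT (zero_lt_one (α := ℝ))
  have hsadε : ∀ ε ∈ Ioo (0 : ℝ) 1, IsRestrictedSaddle K φ (ε • p) := fun ε hε => by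
    have := (convex_setOf_isRestrictedSaddle hK hcont hmono).add_smul_sub_mem hsad hp
      (t := ε) ⟨hε.1.le, hε.2.le⟩
    simpa using this
  -- Replace 0 by the saddle point εp. For r < 1 the point εp + r(z - εp) carries weight (1-r)ε on
  -- `p`, which makes all directions of V feasible; then ε → 0.
  have key : ∀ ε ∈ Ioo (0 : ℝ) 1,
      inner ℝ (field φ (ε • p + r • (z - ε • p))) d = r * inner ℝ (field φ z) d := by
    intro ε hε
    have hpε := hsadε ε hε
    refine inner_eq_smul_inner_of_monotone hcont hmono hpε.1 hpε.2 hz ?_ (hzp _ hpε) hr ?_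
    · rw [real_inner_comm]
      exact (Submodule.mem_orthogonal _ _).1 (field_mem_direction_orthogonal hK hmono hpε) d hd
    · have hne : (1 - r) * ε ≠ 0 := (mul_pos (sub_pos.2 hr1) hε.1).ne'
      have hmul : Tendsto (fun s : ℝ => s * ((1 - r) * ε)⁻¹) (𝓝 0) (𝓝 0) := by
        simpa using (continuous_mul_const (((1 - r) * ε)⁻¹)).tendsto 0
      filter_upwards [hmul.eventually (hpd d hd)] with s hs
      have h1 := hK hsad.1 hs (sub_nonneg.2 hε.2.le) hε.1.le (by ring)
      have h2 := hK h1 hz (sub_nonneg.2 hr1.le) hr.1 (by ring)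
      convert h2 using 1
      have h3 : s = (1 - r) * ε * (s * ((1 - r) * ε)⁻¹) := by
        rw [mul_comm, mul_assoc, inv_mul_cancel₀ hne, mul_one]
      conv_lhs => rw [h3]
      module
  have htend : Tendsto (fun ε : ℝ => ε • p + r • (z - ε • p)) (𝓝[>] 0) (𝓝[K] (r • z)) := by
    refine tendsto_nhdsWithin_iff.2 ⟨?_, ?_⟩
    · have : Continuous fun ε : ℝ => ε • p + r • (z - ε • p) := by fun_prop
      simpa using (this.tendsto 0).mono_left nhdsWithin_le_nhds
    · filter_upwards [hI] with ε hε using hK.add_smul_sub_mem (hsadε ε hε).1 hz hr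
  have hrz : r • z ∈ K := by simpa using hK.add_smul_sub_mem hsad.1 hz hr
  have hlim : Tendsto (fun ε : ℝ => inner ℝ (field φ (ε • p + r • (z - ε • p))) d) (𝓝[>] 0)
      (𝓝 (inner ℝ (field φ (r • z)) d)) :=
    ((hcont _ hrz).tendsto.comp htend).inner tendsto_const_nhds
  refine tendsto_nhds_unique hlim (tendsto_const_nhds.congr' ?_)
  filter_upwards [hI] with ε hε using (key ε hε).symm

/-- The derivative of a monotone field is negative semidefinite in the feasible directions. -/
theorem inner_fderiv_nonpos {E : Type*} [NormedAddCommGroup E] [InnerProductSpace ℝ E] {C : Set E}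
    {f : E → E} (hmono : ∀ u ∈ C, ∀ w ∈ C, inner ℝ (f u - f w) (u - w) ≤ 0) {c d : E}
    {f' : E →L[ℝ] E} (hf : HasFDerivAt f f' c) (hd : ∀ᶠ s in 𝓝 (0 : ℝ), c + s • d ∈ C) :
    inner ℝ (f' d) d ≤ 0 := by
  have hc : c ∈ C := by simpa using hd.self_of_nhds
  have h0 : HasDerivAt (fun t : ℝ => c + t • d) d 0 := by
    simpa using ((hasDerivAt_id (0 : ℝ)).smul_const d).const_add c
  have hf' : HasFDerivAt f f' (c + (0 : ℝ) • d) := by simpa using hf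
  have h1 : HasDerivAt (fun t : ℝ => f (c + t • d)) (f' d) 0 := hf'.comp_hasDerivAt (0 : ℝ) h0
  have h2 := (hasDerivAt_iff_tendsto_slope.mp h1).mono_left
    (nhdsWithin_mono (0 : ℝ) (fun t (ht : t ∈ Ioi (0 : ℝ)) => ne_of_gt ht))
  refine le_of_tendsto (h2.inner tendsto_const_nhds) ?_
  filter_upwards [hd.filter_mono nhdsWithin_le_nhds, self_mem_nhdsWithin] with s hs hs0
  have hs0 : 0 < s := hs0
  have h3 := hmono _ hs _ hc
  rw [add_sub_cancel_left, inner_smul_right] at h3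
  rw [slope_def_module, sub_zero, inner_smul_left, zero_smul, add_zero]
  exact mul_nonpos_of_nonneg_of_nonpos (by simpa using hs0.le) (nonpos_of_mul_nonpos_right h3 hs0)

/-- Moving `u` slightly towards a relatively interior saddle point makes `d` feasible; continuity of
the derivative brings the bound back to `u`, and the skew A contributes nothing. -/
theorem inner_matB_nonpos (hU : IsOpen U) (hKU : K ⊆ U) (hφ : ContDiffOn ℝ 2 φ U)
    (hK : Convex ℝ K) (hcont : ContinuousOn (field φ) K)
    (hmono : ∀ z ∈ K, ∀ w ∈ K, inner ℝ (field φ z - field φ w) (z - w) ≤ 0)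
    (hsad : IsRestrictedSaddle K φ 0) {u : Z n m} (hu : u ∈ K)
    {d : Z n m} (hd : d ∈ (saddleSpan K φ).direction) : inner ℝ (matB φ u d) d ≤ 0 := by
  obtain ⟨p, hp, hpd⟩ := exists_saddle_relativeInterior hK hcont hmono hsad
  have hI := Ioo_mem_nhdsGT (zero_lt_one (α := ℝ))
  have hF : ContinuousOn (fderiv ℝ (field φ)) U :=
    (contDiffOn_field hU hφ).continuousOn_fderiv_of_isOpen hU le_rfl
  have hmem : ∀ ε ∈ Ioo (0 : ℝ) 1, u + ε • (p - u) ∈ K := fun ε hε =>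
    hK.add_smul_sub_mem hu hp.1 ⟨hε.1.le, hε.2.le⟩
  have htend : Tendsto (fun ε : ℝ => u + ε • (p - u)) (𝓝[>] 0) (𝓝[U] u) := by
    refine tendsto_nhdsWithin_iff.2 ⟨?_, ?_⟩
    · have : Continuous fun ε : ℝ => u + ε • (p - u) := by fun_prop
      simpa using (this.tendsto 0).mono_left nhdsWithin_le_nhds
    · filter_upwards [hI] with ε hε using hKU (hmem ε hε)
  have hlim : Tendsto (fun ε : ℝ => inner ℝ (fderiv ℝ (field φ) (u + ε • (p - u)) d) d) (𝓝[>] 0)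
      (𝓝 (inner ℝ (fderiv ℝ (field φ) u d) d)) :=
    (((ContinuousLinearMap.apply ℝ (Z n m) d).continuous.tendsto _).comp
      ((hF u (hKU hu)).tendsto.comp htend)).inner tendsto_const_nhds
  have h : inner ℝ (fderiv ℝ (field φ) u d) d ≤ 0 := by
    refine le_of_tendsto hlim ?_
    filter_upwards [hI] with ε hε
    refine inner_fderiv_nonpos hmono
      (hasFDerivAt_field hU hφ (hKU (hmem ε hε))).differentiableAt.hasFDerivAt ?_
    have hmul : Tendsto (fun s : ℝ => s * ε⁻¹) (𝓝 0) (𝓝 0) := by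
      simpa using (continuous_mul_const (ε⁻¹)).tendsto 0
    filter_upwards [hmul.eventually (hpd d hd)] with s hs
    convert hK hu hs (sub_nonneg.2 hε.2.le) hε.1.le (by ring) using 1
    have h3 : s = ε * (s * ε⁻¹) := by
      have := hε.1.ne'
      field_simp
    conv_lhs => rw [h3]
    module
  rwa [(hasFDerivAt_field hU hφ (hKU hu)).fderiv, add_apply, inner_add_left,
    inner_matA_self hU hφ (hKU hu), zero_add] at h

theorem linOp_eq_and_kernelCondition (hU : IsOpen U) (hKU : K ⊆ U) (hφ : ContDiffOn ℝ 2 φ U)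
    (hK : Convex ℝ K) (hcont : ContinuousOn (field φ) K)
    (hmono : ∀ z ∈ K, ∀ w ∈ K, inner ℝ (field φ z - field φ w) (z - w) ≤ 0)
    (hsad : IsRestrictedSaddle K φ 0) {z : Z n m} (hz : z ∈ K)
    (hzD : z ∈ (saddleSpan K φ).direction)
    (hzp : ∀ p, IsRestrictedSaddle K φ p → inner ℝ (field φ z) (z - p) = 0) :
    projPi K φ (field φ z) = linOp K φ z ∧ KernelCondition K φ z := by
  set D := (saddleSpan K φ).direction with hD
  have hrz : ∀ r ∈ Icc (0 : ℝ) 1, r • z ∈ K := fun r hr => by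
    simpa using hK.add_smul_sub_mem hsad.1 hz hr
  have hderiv : ∀ r ∈ Icc (0 : ℝ) 1, ∀ d ∈ D,
      inner ℝ (matA φ (r • z) z) d + inner ℝ (matB φ (r • z) z) d = inner ℝ (field φ z) d := by
    intro r hr d hd
    have h0 : HasDerivAt (fun t : ℝ => t • z) z r := by
      simpa using (hasDerivAt_id r).smul_const z
    have hf : HasDerivAt (fun t : ℝ => field φ (t • z)) ((matA φ (r • z) + matB φ (r • z)) z) r := by
      have hF := hasFDerivAt_field hU hφ (hKU (hrz r hr))
      exact hF.comp_hasDerivAt r h0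
    have h1 := hf.inner ℝ (hasDerivAt_const r d)
    have h2 : HasDerivWithinAt (fun t : ℝ => inner ℝ (field φ (t • z)) d)
        (1 * inner ℝ (field φ z) d) (Icc 0 1) r :=
      (((hasDerivAt_id r).mul_const (inner ℝ (field φ z) d)).hasDerivWithinAt).congr
        (fun t ht => inner_field_smul hK hcont hmono hsad hz hzp hd ht)
        (inner_field_smul hK hcont hmono hsad hz hzp hd hr)
    -- Linearity is known only on [0, 1], so at the endpoints the derivatives are compared within
    -- it.
    have h3 := (uniqueDiffOn_Icc_zero_one r hr).eq_deriv _ h1.hasDerivWithinAt h2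
    simpa [inner_add_left] using h3
  have hf0 : inner ℝ (field φ z) z = 0 := by simpa using hzp 0 hsad
  have hB : ∀ r ∈ Icc (0 : ℝ) 1, ∀ d ∈ D, inner ℝ (matB φ (r • z) z) d = 0 := by
    intro r hr d hd
    have h1 := hderiv r hr z hzD
    rw [inner_matA_self hU hφ (hKU (hrz r hr)), zero_add, hf0] at h1
    exact inner_eq_zero_of_isotropic (inner_matB hU hφ (hKU (hrz r hr)))
      (fun d hd => inner_matB_nonpos hU hKU hφ hK hcont hmono hsad (hrz r hr) hd) hzD hd h1
  have hA : ∀ r ∈ Icc (0 : ℝ) 1, ∀ d ∈ D,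
      inner ℝ (matA φ (r • z) z) d = inner ℝ (field φ z) d := fun r hr d hd => by
    rw [← hderiv r hr d hd, hB r hr d hd, add_zero]
  have hzero : ∀ v : Z n m, (∀ d ∈ D, inner ℝ v d = 0) → D.starProjection v = 0 := fun v hv => by
    rw [D.starProjection_apply_eq_zero_iff, Submodule.mem_orthogonal']
    exact hv
  have hpz : projPi K φ z = z := by
    rw [projPi_eq]
    exact Submodule.starProjection_eq_self_iff.2 hzD
  have hA0 : ∀ d ∈ D, inner ℝ (matA φ 0 z) d = inner ℝ (field φ z) d := fun d hd => by
    simpa using hA 0 ⟨le_rfl, zero_le_one⟩ d hd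
  refine ⟨?_, fun r hr => ⟨?_, ?_⟩⟩
  · simp only [linOp, ContinuousLinearMap.comp_apply, hpz]
    rw [← sub_eq_zero, ← map_sub, projPi_eq]
    refine hzero _ fun d hd => ?_
    rw [inner_sub_left, hA0 d hd, sub_self]
  · simp only [ContinuousLinearMap.comp_apply, hpz]
    rw [projPi_eq]
    exact hzero _ (hB r hr)
  · simp only [ContinuousLinearMap.comp_apply, hpz]
    rw [projPi_eq]
    refine hzero _ fun d hd => ?_
    rw [sub_apply, inner_sub_left, hA r hr d hd, hA0 d hd, sub_self]

/-- The subgradient dynamics on the limit set, for a trajectory on `[0, ∞)`. -/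
theorem hasDerivWithinAt_linOp_and_kernelCondition (hKclosed : IsClosed K) (hK : Convex ℝ K)
    (hU : IsOpen U) (hKU : K ⊆ U) (hφ : ContDiffOn ℝ 2 φ U) (hcc : IsConcaveConvexOn K φ)
    (hsad : IsRestrictedSaddle K φ 0) {z : ℝ → Z n m}
    (hz : IsSubgradientTrajectory K φ (Ici 0) z) (h0 : z 0 ∈ omegaLimitSet K φ)
    {t : ℝ} (ht : 0 ≤ t) :
    HasDerivWithinAt z (linOp K φ (z t)) (Ici 0) t ∧ KernelCondition K φ (z t) := by
  have hcont : ContinuousOn (field φ) K := (contDiffOn_field hU hφ).continuousOn.mono hKU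
  have hmono := field_monotone hcc fun u hu =>
    (hφ.contDiffAt (hU.mem_nhds (hKU hu))).differentiableAt two_ne_zero
  have hzF := mem_minimalFace_of_mem_omegaLimitSet hKclosed hK hcont hmono hsad hz h0 ht
  have hzD : z t ∈ (saddleSpan K φ).direction := by
    have h := AffineSubspace.vsub_mem_direction (subset_affineSpan ℝ _ hzF)
      (subset_affineSpan ℝ _ (subset_minimalFace hsad))
    rwa [vsub_eq_sub, sub_zero] at h
  obtain ⟨h1, h2⟩ := linOp_eq_and_kernelCondition hU hKU hφ hK hcont hmono hsad (hz.mem t ht) hzD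
    fun p hp => inner_field_eq_zero_of_mem_omegaLimitSet hcont hmono hz h0 hp ht
  rw [← h1]
  exact ⟨hasDerivWithinAt_of_mem_omegaLimitSet hKclosed hK hcont hmono hsad hz h0 ht, h2⟩

end Linear

end SubgradientMethod

theorem mainTheorem5 (n m : ℕ) (K : Set (SubgradientMethod.Z n m))
    (hKclosed : IsClosed K) (hKconvex : Convex ℝ K)
    (φ : SubgradientMethod.Z n m → ℝ)
    (U : Set (SubgradientMethod.Z n m)) (hU : IsOpen U) (hKU : K ⊆ U)
    (hφ : ContDiffOn ℝ 2 φ U)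
    (hcc : SubgradientMethod.IsConcaveConvexOn K φ)
    (h0 : SubgradientMethod.IsRestrictedSaddle K φ 0) :
    (∀ z : ℝ → SubgradientMethod.Z n m,
      SubgradientMethod.IsSubgradientTrajectory K φ Set.univ z →
      (∀ t, z t ∈ SubgradientMethod.omegaLimitSet K φ) →
      ∀ t, HasDerivAt z (SubgradientMethod.linOp K φ (z t)) t ∧
        SubgradientMethod.KernelCondition K φ (z t)) ∧
    (∀ z : ℝ → SubgradientMethod.Z n m,
      SubgradientMethod.IsSubgradientTrajectory K φ (Set.Ici 0) z →
      z 0 ∈ SubgradientMethod.omegaLimitSet K φ →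
      ∀ t ∈ Set.Ici (0 : ℝ),
        HasDerivWithinAt z (SubgradientMethod.linOp K φ (z t)) (Set.Ici 0) t ∧
        SubgradientMethod.KernelCondition K φ (z t)) := by
  have key : ∀ z : ℝ → SubgradientMethod.Z n m,
      SubgradientMethod.IsSubgradientTrajectory K φ (Set.Ici 0) z →
      z 0 ∈ SubgradientMethod.omegaLimitSet K φ → ∀ t ∈ Set.Ici (0 : ℝ),
        HasDerivWithinAt z (SubgradientMethod.linOp K φ (z t)) (Set.Ici 0) t ∧
        SubgradientMethod.KernelCondition K φ (z t) := fun z hz hz0 t ht =>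
    SubgradientMethod.hasDerivWithinAt_linOp_and_kernelCondition hKclosed hKconvex hU hKU
      hφ hcc h0 hz hz0 ht
  refine ⟨fun z hz hzΩ t => ?_, key⟩
  -- Restarting at t - 1 turns t into the interior time 1, where the one-sided derivative is
  -- two-sided.
  obtain ⟨h1, h2⟩ := key (fun s => z (t - 1 + s)) (hz.shift (Set.subset_univ _)) (hzΩ _) 1
    (Set.mem_Ici.2 zero_le_one)
  have h3 := h1.hasDerivAt (Ici_mem_nhds zero_lt_one)
  rw [← sub_sub_cancel t 1] at h3
  have h4 := h3.comp_sub_const t (t - 1)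
  simp only [add_sub_cancel, sub_sub_cancel, sub_add_cancel] at h2 h4
  exact ⟨h4, h2⟩
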